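/- A *hole* is a set $S=J\cup I\subset\mathbb R^2$, where $J$ is a simple closed rectilinear curve and $I$ is the bounded region of $\mathbb R^2\setminus J$. Its vertices are assumed to be integral, and $nv(S)$ is their number. It is stored as the doubly linked cyclic list of its vertices in anticlockwise order (interior on the left). A vertical edge is a *leftmost edge* (a *rightmost edge*) if the interior and both adjacent edges lie to its right (to its left). It is a *left notch* (a *right notch*) if the interior lies to its right (left) and both adjacent edges lie to its left (right). A *top notch* is a horizontal edge below which the interior lies and whose adjacent edges both lie above it. A *falling corner* is a vertex that the clockwise traversal enters downwards and leaves rightwards. $S$ is a *nice hole* if it has no left, right or top notch and at most one falling corner. Let $S$ be a nice hole with leftmost edge $L$ and rightmost edge $R$ (pointers to both are given), and let the lower boundary $FB$ be the part of the boundary traversed anticlockwise strictly between $L$ and $R$. Let $S_{bot}$ be the closed region bounded by $FB$ and the three segments that join the lower vertex of $L$, the points $(x(L),y_{\max}(S))$ and $(x(R),y_{\max}(S))$, and the lower vertex of $R$, in this order. Let $w\ge 1$ be an integer such that the first edge of $FB$ has length at least $w$. For integers $p\in[x(L),x(R)-w]$ put $$f(p)=\min\{y\in\mathbb R : [p,p+w]\times\{y\}\subseteq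 S_{bot}\}.$$ The ordered breakpoint list $C$ consists of the point $(x(L),f(x(L)))$; then, for $p=x(L),\dots,x(R)-w$ in increasing order, the pair $(p,f(p-1)),(p,f(p))$ if $p>x(L)$ and $f(p-1)>f(p)$, followed by the pair $(p,f(p)),(p,f(p+1))$ if $p<x(R)-w$ and $f(p+1)>f(p)$; and finally the point $(x(R)-w,f(x(R)-w))$. (If both pairs occur at the same $p$, three distinct points have abscissa $p$ and $(p,f(p))$ is listed twice.) *The Bottom-function.* Let $e_0=L,e_1,\dots,e_m=R$ be the vertical edges from $L$ to $R$ in anticlockwise order, $h_i,d_i$ the upper and lower vertex of $e_i$, and $a_i$ the horizontal edge between $e_{i-1}$ and $e_i$. $Q,Q'$ are deques of horizontal edges, and $C_{alg}$ is a list of points. 1. Set $b_1=d_0$, $b_2=b_1+(w,0)$, $C_{alg}=(b_1)$, $Q=\emptyset$, $start=r=1$, and let $support$ be the vertex of $e_1$ at the height of $b_1$. 2. While $x(e_r)<x(support)+w$: if $r=m$, append $(x(R)-w,\,y(\text{last point of }C_{alg}))$ to $C_{alg}$ and return $C_{alg}$. Otherwise, if $y(h_r)>y(support)$, append $(x(h_r)-w,\,y(\text{last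 point of }C_{alg}))$ and $h_r-(w,0)$ to $C_{alg}$, set $b_1=h_r-(w,0)$, $b_2=h_r$, $Q=\emptyset$, let $support$ be the vertex of $e_{r+1}$ at the height of $b_1$, and set $start$ and $r$ to $r+1$. Otherwise increase $r$ by $1$. 3. Set $b_1=support$, $b_2=b_1+(w,0)$. SETUP: set $Q'=\emptyset$; for $k=r,r-1,\dots,start+1$ insert $a_k$ at the front of $Q'$ if $Q'=\emptyset$ or $a_k$ is strictly higher than the front of $Q'$. MERGE: while $Q,Q'\neq\emptyset$ and the back of $Q$ is not higher than the front of $Q'$, remove the back of $Q$; then move the edges of $Q'$ in order to the back of $Q$. Remove the front $a$ of $Q$ and lower $b_1,b_2$ to the height of $a$. If $y(b_1)\ne y(support)$, append $support,b_1$ to $C_{alg}$. Set $support$ to the right vertex of $a$, $start=r$, and go to step 2. Running time is the number of elementary steps (integer arithmetic and comparisons, moves along the vertex list, operations at the ends of deques and of the output list). **Theorem.** The minimum defining $f(p)$ exists for every integer $p\in[x(L),x(R)-w]$, and the Bottom-function halts and returns exactly the ordered list $C$, including both pairs at each abscissa where a fall and a rise coincide. There is an absolute constant $K$ such that it takes at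 most $K\cdot nv(S)$ steps for every such input. -/

import Mathlib

open Set Filter Topology

namespace RectHole

/-! ## Holes

The boundary of a hole with integral vertices is stored as the cyclic list `v : ZMod n → ℤ × ℤ`
of its `n` vertices in anticlockwise order; edge `i` runs from `v i` to `v (i + 1)`.
A move along the doubly linked list is `i ↦ i + 1` or `i ↦ i - 1`. -/

/-- An integral point as a point of the plane. -/
def toPlane (p : ℤ × ℤ) : ℝ × ℝ := ((p.1 : ℝ), (p.2 : ℝ))

/-- Edge `i` as a closed straight line segment in the plane. -/
def edgeSet {n : ℕ} (v : ZMod n → ℤ × ℤ) (i : ZMod n) : Set (ℝ × ℝ) :=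
  segment ℝ (toPlane (v i)) (toPlane (v (i + 1)))

/-- The closed curve with vertices `v`. -/
def boundary {n : ℕ} (v : ZMod n → ℤ × ℤ) : Set (ℝ × ℝ) := ⋃ i, edgeSet v i

/-- The inner region of a closed curve `J`: the points off `J` whose connected region
in the complement of `J` is bounded. -/
def innerRegion (J : Set (ℝ × ℝ)) : Set (ℝ × ℝ) :=
  {p | p ∉ J ∧ Bornology.IsBounded (connectedComponentIn Jᶜ p)}

/-- Direction in which edge `i` is traversed, in the order of the list `v`. -/
def Rightward {n : ℕ} (v : ZMod n → ℤ × ℤ) (i : ZMod n) : Prop :=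
  (v i).2 = (v (i + 1)).2 ∧ (v i).1 < (v (i + 1)).1

def Leftward {n : ℕ} (v : ZMod n → ℤ × ℤ) (i : ZMod n) : Prop :=
  (v i).2 = (v (i + 1)).2 ∧ (v (i + 1)).1 < (v i).1

def Upward {n : ℕ} (v : ZMod n → ℤ × ℤ) (i : ZMod n) : Prop :=
  (v i).1 = (v (i + 1)).1 ∧ (v i).2 < (v (i + 1)).2

def Downward {n : ℕ} (v : ZMod n → ℤ × ℤ) (i : ZMod n) : Prop :=
  (v i).1 = (v (i + 1)).1 ∧ (v (i + 1)).2 < (v i).2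

def Horizontal {n : ℕ} (v : ZMod n → ℤ × ℤ) (i : ZMod n) : Prop :=
  Rightward v i ∨ Leftward v i

def Vertical {n : ℕ} (v : ZMod n → ℤ × ℤ) (i : ZMod n) : Prop :=
  Upward v i ∨ Downward v i

/-- `v` lists, in anticlockwise order, the vertices of a simple closed rectilinear curve.
The hole itself is `boundary v ∪ innerRegion (boundary v)`. -/
structure IsHole {n : ℕ} (v : ZMod n → ℤ × ℤ) : Prop where
  four_le : 4 ≤ n
  /-- Horizontal and vertical edges alternate, so every edge is a maximal segment. -/
  alternate : ∀ i, (Horizontal v i ∧ Vertical v (i + 1)) ∨ (Vertical v i ∧ Horizontal v (i + 1))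
  /-- Edges that are not neighbours do not meet. -/
  simple : ∀ i j, i ≠ j → j ≠ i + 1 → i ≠ j + 1 → Disjoint (edgeSet v i) (edgeSet v j)
  /-- The order is anticlockwise: the inner region lies immediately to the left of each edge. -/
  anticlockwise : ∀ i, ∀ t ∈ Ioo (0 : ℝ) 1, ∀ᶠ ε in 𝓝[>] (0 : ℝ),
    AffineMap.lineMap (toPlane (v i)) (toPlane (v (i + 1))) t
      + ε • ((toPlane (v i)).2 - (toPlane (v (i + 1))).2,
             (toPlane (v (i + 1))).1 - (toPlane (v i)).1)
      ∈ innerRegion (boundary v)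

/-- A leftmost edge: a vertical edge with both neighbours and the interior to its right.
(In anticlockwise order the interior is to the right of an edge exactly if the edge is
traversed downwards; likewise below.) -/
def IsLeftmostEdge {n : ℕ} (v : ZMod n → ℤ × ℤ) (i : ZMod n) : Prop :=
  Leftward v (i - 1) ∧ Downward v i ∧ Rightward v (i + 1)

/-- A rightmost edge: both neighbours and the interior lie to its left. -/
def IsRightmostEdge {n : ℕ} (v : ZMod n → ℤ × ℤ) (i : ZMod n) : Prop :=
  Rightward v (i - 1) ∧ Upward v i ∧ Leftward v (i + 1)

/-- A left notch: both neighbours lie to the left of the vertical edge, the interior to its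
right. -/
def IsLeftNotch {n : ℕ} (v : ZMod n → ℤ × ℤ) (i : ZMod n) : Prop :=
  Rightward v (i - 1) ∧ Downward v i ∧ Leftward v (i + 1)

/-- A right notch: both neighbours lie to the right of the vertical edge, the interior to its
left. -/
def IsRightNotch {n : ℕ} (v : ZMod n → ℤ × ℤ) (i : ZMod n) : Prop :=
  Leftward v (i - 1) ∧ Upward v i ∧ Rightward v (i + 1)

/-- A top notch: both neighbours lie above the horizontal edge, the interior below it. -/
def IsTopNotch {n : ℕ} (v : ZMod n → ℤ × ℤ) (i : ZMod n) : Prop :=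
  Downward v (i - 1) ∧ Leftward v i ∧ Upward v (i + 1)

/-- A falling corner: a vertex which the clockwise traversal enters downwards and leaves
rightwards, i.e. which the anticlockwise traversal enters leftwards and leaves upwards. -/
def IsFallingCorner {n : ℕ} (v : ZMod n → ℤ × ℤ) (i : ZMod n) : Prop :=
  Leftward v (i - 1) ∧ Upward v i

/-- A BLS-hole: no right notch, no top notch, at most one falling corner. -/
structure IsBLSHole {n : ℕ} (v : ZMod n → ℤ × ℤ) : Prop extends IsHole v where
  no_right_notch : ∀ i, ¬ IsRightNotch v i
  no_top_notch : ∀ i, ¬ IsTopNotch v i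
  falling_corner_unique : ∀ i j, IsFallingCorner v i → IsFallingCorner v j → i = j

/-- A nice hole: a BLS-hole without left notches. -/
structure IsNiceHole {n : ℕ} (v : ZMod n → ℤ × ℤ) : Prop extends IsBLSHole v where
  no_left_notch : ∀ i, ¬ IsLeftNotch v i

/-- Upper vertex of a vertical edge. -/
def upper {n : ℕ} (v : ZMod n → ℤ × ℤ) (i : ZMod n) : ℤ × ℤ :=
  if (v (i + 1)).2 ≤ (v i).2 then v i else v (i + 1)

/-- Lower vertex of a vertical edge. -/
def lower {n : ℕ} (v : ZMod n → ℤ × ℤ) (i : ZMod n) : ℤ × ℤ :=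
  if (v (i + 1)).2 ≤ (v i).2 then v (i + 1) else v i

/-- Right vertex of a horizontal edge. -/
def rightVertex {n : ℕ} (v : ZMod n → ℤ × ℤ) (i : ZMod n) : ℤ × ℤ :=
  if (v (i + 1)).1 ≤ (v i).1 then v i else v (i + 1)

/-! ## The lowest position of a bar -/

/-- The lower boundary: the part of the boundary which the anticlockwise traversal passes
strictly between the edges `L` and `R`. -/
def lowerBoundary {n : ℕ} (v : ZMod n → ℤ × ℤ) (L R : ZMod n) : Set (ℝ × ℝ) :=
  {p | ∃ k : ℕ, 1 ≤ k ∧ k < (R - L).val ∧ p ∈ edgeSet v (L + k)}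

/-- The largest `y`-coordinate of the hole. -/
def yMax {n : ℕ} [NeZero n] (v : ZMod n → ℤ × ℤ) : ℤ :=
  Finset.univ.sup' ⟨0, Finset.mem_univ 0⟩ fun i => (v i).2

/-- The boundary of `S_bot`: the lower boundary, closed up by straight segments through the two
points at height `yMax` above `L` and `R`. -/
def botBoundary {n : ℕ} [NeZero n] (v : ZMod n → ℤ × ℤ) (L R : ZMod n) : Set (ℝ × ℝ) :=
  lowerBoundary v L R
    ∪ segment ℝ (toPlane (lower v L)) (toPlane ((v L).1, yMax v))
    ∪ segment ℝ (toPlane ((v L).1, yMax v)) (toPlane ((v R).1, yMax v))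
    ∪ segment ℝ (toPlane ((v R).1, yMax v)) (toPlane (lower v R))

/-- The closed region `S_bot`. -/
def botRegion {n : ℕ} [NeZero n] (v : ZMod n → ℤ × ℤ) (L R : ZMod n) : Set (ℝ × ℝ) :=
  botBoundary v L R ∪ innerRegion (botBoundary v L R)

/-- The heights at which a horizontal bar of length `w` with left end at abscissa `p` lies
in `S_bot`. -/
def barHeights {n : ℕ} [NeZero n] (v : ZMod n → ℤ × ℤ) (L R : ZMod n) (w : ℕ) (p : ℤ) : Set ℝ :=
  {y | segment ℝ ((p : ℝ), y) ((p : ℝ) + w, y) ⊆ botRegion v L R}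

/-- The lowest-bar function `f`. -/
noncomputable def lowestBar {n : ℕ} [NeZero n] (v : ZMod n → ℤ × ℤ) (L R : ZMod n) (w : ℕ)
    (p : ℤ) : ℝ :=
  sInf (barHeights v L R w p)

/-- The breakpoints of `f : {a, …, b} → ℝ` at the abscissa `p`: a pair for a fall from `p - 1` to
`p`, then a pair for a rise from `p` to `p + 1`. If both occur, `(p, f p)` is listed twice. -/
noncomputable def breakpointsAt (f : ℤ → ℝ) (a b p : ℤ) : List (ℝ × ℝ) :=
  (if a < p ∧ f p < f (p - 1) then [((p : ℝ), f (p - 1)), ((p : ℝ), f p)] else []) ++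
  (if p < b ∧ f p < f (p + 1) then [((p : ℝ), f p), ((p : ℝ), f (p + 1))] else [])

/-- The ordered breakpoint set `C` of `f : {a, …, b} → ℝ`, with multiplicities. -/
noncomputable def breakpoints (f : ℤ → ℝ) (a b : ℤ) : List (ℝ × ℝ) :=
  ((a : ℝ), f a) ::
    (List.range (b - a + 1).toNat).flatMap (fun j => breakpointsAt f a b (a + j))
    ++ [((b : ℝ), f b)]

/-! ## The Bottom-function

The algorithm as a machine. One step performs a bounded number of elementary operations:
arithmetic and comparisons of integers, moves along the doubly linked vertex list, and insertions
and removals at the ends of a deque or of the output. The running time is the number of steps.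
Deques are lists whose head is the front. -/

/-- Control locations. -/
inductive Loc
  /-- initialisation -/
  | init
  /-- test and body of the inner loop -/
  | scan
  /-- the inner loop has ended; `SETUP` is entered -/
  | drop
  /-- loop of `SETUP` -/
  | setup
  /-- first part of `MERGE`: removal of edges from the back of `Q` -/
  | merge
  /-- second part of `MERGE`: `Q'` is appended to `Q`, one edge at a time -/
  | append
  /-- the bar is lowered onto the front of `Q` -/
  | lowerBar
  /-- regular halt -/
  | done
  /-- the front of an empty deque was asked for -/
  | stuck

structure State (n : ℕ) where
  loc : Loc
  /-- left end of the bar -/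
  b₁ : ℤ × ℤ
  /-- right end of the bar -/
  b₂ : ℤ × ℤ
  /-- the list `C_alg` of the points found so far -/
  out : List (ℤ × ℤ)
  /-- deque of horizontal edges -/
  Q : List (ZMod n)
  /-- deque built by `SETUP` -/
  Q' : List (ZMod n)
  support : ℤ × ℤ
  /-- pointer to a vertical edge -/
  start : ZMod n
  /-- pointer to a vertical edge -/
  r : ZMod n
  /-- pointer to a horizontal edge, the loop variable of `SETUP` -/
  k : ZMod n

def initial (n : ℕ) : State n :=
  ⟨.init, (0, 0), (0, 0), [], [], [], (0, 0), 0, 0, 0⟩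

/-- The end vertex of the vertical edge `e` on the horizontal line through `b`. -/
def onLine {n : ℕ} (v : ZMod n → ℤ × ℤ) (e : ZMod n) (b : ℤ × ℤ) : ℤ × ℤ :=
  if (upper v e).2 = b.2 then upper v e else lower v e

/-- One step. The vertical edges from `L` to `R` are `L, L + 2, L + 4, …, R`, the horizontal edge
before the vertical edge `e` is `e - 1`. -/
def step {n : ℕ} (v : ZMod n → ℤ × ℤ) (L R : ZMod n) (w : ℕ) (s : State n) : State n :=
  match s.loc with
  | .init =>
      let b₁ := lower v L
      { s with
        loc := .scan, b₁ := b₁, b₂ := (b₁.1 + w, b₁.2), out := [b₁], Q := [],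
        support := onLine v (L + 2) b₁, start := L + 2, r := L + 2 }
  | .scan =>
      if (v s.r).1 < s.support.1 + w then
        if s.r = R then
          { s with
            loc := .done, out := s.out ++ [((v R).1 - w, (s.out.getLastD (0, 0)).2)] }
        else if s.support.2 < (upper v s.r).2 then
          let h := upper v s.r
          let u : ℤ × ℤ := (h.1 - w, (s.out.getLastD (0, 0)).2)
          let b₁ : ℤ × ℤ := (h.1 - w, h.2)
          { s with
            b₁ := b₁, b₂ := h, out := s.out ++ [u, b₁], Q := [],
            support := onLine v (s.r + 2) b₁, start := s.r + 2, r := s.r + 2 }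
        else
          { s with r := s.r + 2 }
      else
        { s with loc := .drop }
  | .drop =>
      { s with
        loc := .setup, b₁ := s.support, b₂ := (s.support.1 + w, s.support.2),
        Q' := [], k := s.r - 1 }
  | .setup =>
      if s.k = s.start - 1 then
        { s with loc := .merge }
      else
        match s.Q' with
        | [] => { s with Q' := [s.k], k := s.k - 2 }
        | e :: es =>
            if (v e).2 < (v s.k).2 then
              { s with Q' := s.k :: e :: es, k := s.k - 2 }
            else
              { s with k := s.k - 2 }
  | .merge =>
      match s.Q.getLast?, s.Q'.head? with
      | some a, some e =>
          if (v a).2 ≤ (v e).2 then { s with Q := s.Q.dropLast } else { s with loc := .append }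
      | _, _ => { s with loc := .append }
  | .append =>
      match s.Q' with
      | [] => { s with loc := .lowerBar }
      | e :: es => { s with Q := s.Q ++ [e], Q' := es }
  | .lowerBar =>
      match s.Q with
      | [] => { s with loc := .stuck }
      | a :: q =>
          let δ := s.b₁.2 - (v a).2
          let b₁ : ℤ × ℤ := (s.b₁.1, s.b₁.2 - δ)
          { s with
            loc := .scan, Q := q, b₁ := b₁, b₂ := (s.b₂.1, s.b₂.2 - δ),
            out := if b₁.2 ≠ s.support.2 then s.out ++ [s.support, b₁] else s.out,
            support := rightVertex v a, start := s.r }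
  | .done => s
  | .stuck => s

end RectHole

open RectHole

namespace RectHole

/-! ## Incidences of edges -/

/-- The integral point `(x, y)` lies on the axis-parallel edge `i`. -/
def OnEdge {n : ℕ} (v : ZMod n → ℤ × ℤ) (i : ZMod n) (x y : ℤ) : Prop :=
  ((v i).1 ≤ x ∧ x ≤ (v (i + 1)).1 ∨ (v (i + 1)).1 ≤ x ∧ x ≤ (v i).1) ∧
    ((v i).2 ≤ y ∧ y ≤ (v (i + 1)).2 ∨ (v (i + 1)).2 ≤ y ∧ y ≤ (v i).2)

theorem segment_horizontal (x₁ x₂ y : ℝ) :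
    segment ℝ (x₁, y) (x₂, y) = {q | q.1 ∈ Set.uIcc x₁ x₂ ∧ q.2 = y} := by
  rw [← Prod.image_mk_segment_left, segment_eq_uIcc]
  ext ⟨a, b⟩
  simp only [Set.mem_image, Prod.mk.injEq, Set.mem_ofPred_eq]
  constructor
  · rintro ⟨z, hz, rfl, rfl⟩
    exact ⟨hz, rfl⟩
  · rintro ⟨hz, rfl⟩
    exact ⟨a, hz, rfl, rfl⟩

theorem segment_vertical (x y₁ y₂ : ℝ) :
    segment ℝ (x, y₁) (x, y₂) = {q | q.1 = x ∧ q.2 ∈ Set.uIcc y₁ y₂} := by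
  rw [← Prod.image_mk_segment_right, segment_eq_uIcc]
  ext ⟨a, b⟩
  simp only [Set.mem_image, Prod.mk.injEq, Set.mem_ofPred_eq]
  constructor
  · rintro ⟨z, hz, rfl, rfl⟩
    exact ⟨rfl, hz⟩
  · rintro ⟨rfl, hz⟩
    exact ⟨b, hz, rfl, rfl⟩

theorem OnEdge.mem_edgeSet {n : ℕ} {v : ZMod n → ℤ × ℤ} {i : ZMod n} {x y : ℤ}
    (h : OnEdge v i x y) (hi : Horizontal v i ∨ Vertical v i) :
    toPlane (x, y) ∈ edgeSet v i := by
  obtain ⟨hx, hy⟩ := h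
  unfold edgeSet toPlane
  rcases hi with hi | hi
  · have e : (v i).2 = (v (i + 1)).2 := by rcases hi with hi | hi <;> exact hi.1
    rw [← e, segment_horizontal]
    refine ⟨Set.mem_uIcc.2 (by dsimp only; exact_mod_cast hx), ?_⟩
    have : y = (v i).2 := by omega
    simp [this]
  · have e : (v i).1 = (v (i + 1)).1 := by rcases hi with hi | hi <;> exact hi.1
    rw [← e, segment_vertical]
    refine ⟨?_, Set.mem_uIcc.2 (by dsimp only; exact_mod_cast hy)⟩
    have : x = (v i).1 := by omega
    simp [this]

namespace IsHole

variable {n : ℕ} {v : ZMod n → ℤ × ℤ}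

theorem horizontal_or_vertical (hv : IsHole v) (i : ZMod n) :
    Horizontal v i ∨ Vertical v i := by
  rcases hv.alternate i with h | h
  · exact Or.inl h.1
  · exact Or.inr h.1

theorem not_horizontal_of_vertical {i : ZMod n} (h : Vertical v i) : ¬ Horizontal v i := by
  unfold Horizontal Vertical Rightward Leftward Upward Downward at *
  omega

theorem vertical_succ (hv : IsHole v) {i : ZMod n} (h : Horizontal v i) : Vertical v (i + 1) := by
  rcases hv.alternate i with h' | h'
  · exact h'.2
  · exact absurd h (not_horizontal_of_vertical h'.1)

theorem horizontal_succ (hv : IsHole v) {i : ZMod n} (h : Vertical v i) :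
    Horizontal v (i + 1) := by
  rcases hv.alternate i with h' | h'
  · exact absurd h'.1 (not_horizontal_of_vertical h)
  · exact h'.2

theorem not_horizontal_succ (hv : IsHole v) {i : ZMod n} (h : Horizontal v i) :
    ¬ Horizontal v (i + 1) :=
  not_horizontal_of_vertical (hv.vertical_succ h)

theorem not_vertical_succ (hv : IsHole v) {i : ZMod n} (h : Vertical v i) :
    ¬ Vertical v (i + 1) := fun h' => not_horizontal_of_vertical h' (hv.horizontal_succ h)

theorem eq_or_adjacent (hv : IsHole v) {i j : ZMod n} {x y : ℤ} (hi : OnEdge v i x y)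
    (hj : OnEdge v j x y) : i = j ∨ j = i + 1 ∨ i = j + 1 := by
  by_contra! h
  exact Set.disjoint_left.1 (hv.simple i j h.1 h.2.1 h.2.2)
    (hi.mem_edgeSet (hv.horizontal_or_vertical i)) (hj.mem_edgeSet (hv.horizontal_or_vertical j))

theorem eq_of_horizontal (hv : IsHole v) {i j : ZMod n} {x y : ℤ} (hi : OnEdge v i x y)
    (hj : OnEdge v j x y) (hi' : Horizontal v i) (hj' : Horizontal v j) : j = i := by
  rcases hv.eq_or_adjacent hi hj with h | rfl | rfl
  · exact h.symm
  · exact absurd hj' (hv.not_horizontal_succ hi')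
  · exact absurd hi' (hv.not_horizontal_succ hj')

theorem eq_of_vertical (hv : IsHole v) {i j : ZMod n} {x y : ℤ} (hi : OnEdge v i x y)
    (hj : OnEdge v j x y) (hi' : Vertical v i) (hj' : Vertical v j) : j = i := by
  rcases hv.eq_or_adjacent hi hj with h | rfl | rfl
  · exact h.symm
  · exact absurd hj' (hv.not_vertical_succ hi')
  · exact absurd hi' (hv.not_vertical_succ hj')

theorem adjacent_of_horizontal_of_vertical (hv : IsHole v) {i j : ZMod n} {x y : ℤ}
    (hi : OnEdge v i x y) (hj : OnEdge v j x y) (hi' : Horizontal v i) (hj' : Vertical v j) :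
    j = i + 1 ∨ i = j + 1 := by
  rcases hv.eq_or_adjacent hi hj with rfl | h
  · exact absurd hi' (not_horizontal_of_vertical hj')
  · exact h

end IsHole

/-! ## The winding number of the unit squares -/

/-- The winding number of the curve about the unit square with lower left corner `(c, h)`. -/
def winding {n : ℕ} [NeZero n] (v : ZMod n → ℤ × ℤ) (c h : ℤ) : ℤ :=
  ∑ j, (if (v j).2 ≤ h then 1 else 0) *
    ((if (v j).1 ≤ c then 1 else 0) - (if (v (j + 1)).1 ≤ c then 1 else 0))

/-- The horizontal edge `i` passes over the unit interval that starts at `c`. -/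
def Spans {n : ℕ} (v : ZMod n → ℤ × ℤ) (i : ZMod n) (c : ℤ) : Prop :=
  (v i).1 ≤ c ∧ c < (v (i + 1)).1 ∨ (v (i + 1)).1 ≤ c ∧ c < (v i).1

/-- The vertical edge `i` passes along the unit interval that starts at `h`. -/
def SpansRow {n : ℕ} (v : ZMod n → ℤ × ℤ) (i : ZMod n) (h : ℤ) : Prop :=
  (v i).2 ≤ h ∧ h < (v (i + 1)).2 ∨ (v (i + 1)).2 ≤ h ∧ h < (v i).2

section Winding

variable {n : ℕ} [NeZero n] {v : ZMod n → ℤ × ℤ}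

theorem winding_eq (c h : ℤ) : winding v c h =
    ∑ j, (if (v (j + 1)).1 ≤ c then 1 else 0) *
      ((if (v (j + 1)).2 ≤ h then 1 else 0) - (if (v j).2 ≤ h then 1 else 0)) := by
  have := Equiv.sum_comp (Equiv.addRight (1 : ZMod n))
    (fun j => (if (v j).2 ≤ h then (1 : ℤ) else 0) * (if (v j).1 ≤ c then 1 else 0))
  simp only [Equiv.coe_addRight] at this
  simp only [winding, mul_sub, Finset.sum_sub_distrib]
  rw [← this, sub_left_inj.2 (Finset.sum_congr rfl fun j _ => mul_comm _ _)]
  congr 1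
  exact Finset.sum_congr rfl fun j _ => mul_comm _ _

theorem winding_sub_row (c h : ℤ) : winding v c h - winding v c (h - 1) =
    ∑ j, (if (v j).2 = h then 1 else 0) *
      ((if (v j).1 ≤ c then 1 else 0) - (if (v (j + 1)).1 ≤ c then 1 else 0)) := by
  rw [winding, winding, ← Finset.sum_sub_distrib]
  refine Finset.sum_congr rfl fun j _ => ?_
  split_ifs <;> omega

theorem winding_sub_col (c h : ℤ) : winding v c h - winding v (c - 1) h =
    ∑ j, (if (v (j + 1)).1 = c then 1 else 0) *
      ((if (v (j + 1)).2 ≤ h then 1 else 0) - (if (v j).2 ≤ h then 1 else 0)) := by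
  rw [winding_eq, winding_eq, ← Finset.sum_sub_distrib]
  refine Finset.sum_congr rfl fun j _ => ?_
  split_ifs <;> omega

theorem IsHole.winding_row_eq (hv : IsHole v) {c h : ℤ}
    (H : ∀ j, Horizontal v j → (v j).2 = h → OnEdge v j c h → OnEdge v j (c + 1) h → False) :
    winding v c h = winding v c (h - 1) := by
  rw [← sub_eq_zero, winding_sub_row]
  refine Finset.sum_eq_zero fun j _ => ?_
  by_contra h0
  have := hv.horizontal_or_vertical j
  unfold Horizontal Vertical Rightward Leftward Upward Downward at this
  refine H j ?_ ?_ ?_ ?_ <;>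
  · try unfold OnEdge
    try unfold Horizontal Rightward Leftward
    split_ifs at h0 <;> simp at h0 <;> omega

theorem IsHole.winding_col (hv : IsHole v) {i : ZMod n} {h : ℤ} (hi : Vertical v i)
    (hc : SpansRow v i h) : winding v (v i).1 h - winding v ((v i).1 - 1) h =
      (if (v (i + 1)).2 ≤ h then 1 else 0) - (if (v i).2 ≤ h then 1 else 0) := by
  rw [winding_sub_col, Finset.sum_eq_single i]
  · have : (v (i + 1)).1 = (v i).1 := by rcases hi with hi | hi <;> exact hi.1.symm
    simp [this]
  · intro j _ hj
    by_contra h0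
    refine hj (hv.eq_of_vertical (x := (v i).1) (y := h) ?_ ?_ hi ?_)
    · unfold OnEdge SpansRow at *; unfold Vertical Upward Downward at hi; omega
    all_goals
      have := hv.horizontal_or_vertical j
      unfold Horizontal Vertical Rightward Leftward Upward Downward at this
      try unfold OnEdge
      try unfold Vertical Upward Downward
      split_ifs at h0 <;> simp at h0 <;> omega
  · simp

theorem IsHole.winding_col_eq (hv : IsHole v) {c h : ℤ}
    (H : ∀ j, Vertical v j → (v j).1 = c → OnEdge v j c h → OnEdge v j c (h + 1) → False) :
    winding v c h = winding v (c - 1) h := by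
  rw [← sub_eq_zero, winding_sub_col]
  refine Finset.sum_eq_zero fun j _ => ?_
  by_contra h0
  have := hv.horizontal_or_vertical j
  unfold Horizontal Vertical Rightward Leftward Upward Downward at this
  refine H j ?_ ?_ ?_ ?_ <;>
  · try unfold OnEdge
    try unfold Vertical Upward Downward
    split_ifs at h0 <;> simp at h0 <;> omega

end Winding

/-! ## The winding number along the curve -/

theorem eq_of_eq_pred {g : ℤ → ℤ} {a b : ℤ} (H : ∀ c, a < c → c < b → g c = g (c - 1)) {c c' : ℤ}
    (hc : a ≤ c) (hc' : c < b) (hd : a ≤ c') (hd' : c' < b) : g c = g c' := by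
  have key : ∀ d, a ≤ d → d < b → g d = g a := by
    intro d hd
    induction d, hd using Int.leInduction with
    | base => exact fun _ => rfl
    | succ d hd ih =>
      intro h
      rw [H (d + 1) (by omega) h, add_sub_cancel_right, ih (by omega)]
  rw [key c hc hc', key c' hd hd']

/-- All unit squares immediately to the right of edge `i` have winding number `κ`. -/
structure RightWinding {n : ℕ} [NeZero n] (v : ZMod n → ℤ × ℤ) (κ : ℤ) (i : ZMod n) : Prop where
  rightward : Rightward v i → ∀ c, (v i).1 ≤ c → c < (v (i + 1)).1 →
    winding v c ((v i).2 - 1) = κ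
  leftward : Leftward v i → ∀ c, (v (i + 1)).1 ≤ c → c < (v i).1 → winding v c (v i).2 = κ
  upward : Upward v i → ∀ h, (v i).2 ≤ h → h < (v (i + 1)).2 → winding v (v i).1 h = κ
  downward : Downward v i → ∀ h, (v (i + 1)).2 ≤ h → h < (v i).2 →
    winding v ((v i).1 - 1) h = κ

namespace IsHole

variable {n : ℕ} [NeZero n] {v : ZMod n → ℤ × ℤ}

theorem winding_along_horizontal (hv : IsHole v) {i : ZMod n} (hi : Horizontal v i) {c h : ℤ}
    (hh : h = (v i).2 ∨ h = (v i).2 - 1)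
    (hc : (v i).1 < c ∧ c < (v (i + 1)).1 ∨ (v (i + 1)).1 < c ∧ c < (v i).1) :
    winding v c h = winding v (c - 1) h := by
  refine hv.winding_col_eq fun j hj hjc h1 h2 => ?_
  have hon : OnEdge v j c (v i).2 := by
    rcases hh with rfl | rfl
    · exact h1
    · simpa using h2
  have hoi : OnEdge v i c (v i).2 := by
    unfold OnEdge; unfold Horizontal Rightward Leftward at hi; omega
  rcases hv.adjacent_of_horizontal_of_vertical hoi hon hi hj with rfl | rfl
  · omega
  · unfold Vertical Upward Downward at hj; omega

theorem winding_along_vertical (hv : IsHole v) {i : ZMod n} (hi : Vertical v i) {c h : ℤ}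
    (hh : c = (v i).1 ∨ c = (v i).1 - 1)
    (hc : (v i).2 < h ∧ h < (v (i + 1)).2 ∨ (v (i + 1)).2 < h ∧ h < (v i).2) :
    winding v c h = winding v c (h - 1) := by
  refine hv.winding_row_eq fun j hj hjc h1 h2 => ?_
  have hon : OnEdge v j (v i).1 h := by
    rcases hh with rfl | rfl
    · exact h1
    · simpa using h2
  have hoi : OnEdge v i (v i).1 h := by
    unfold OnEdge; unfold Vertical Upward Downward at hi; omega
  rcases hv.adjacent_of_horizontal_of_vertical hon hoi hj hi with rfl | rfl
  · unfold Horizontal Rightward Leftward at hj; omega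
  · omega

theorem rightWinding_of_rightward (hv : IsHole v) {i : ZMod n} {κ : ℤ} (hi : Rightward v i)
    {c : ℤ} (h1 : (v i).1 ≤ c) (h2 : c < (v (i + 1)).1) (hw : winding v c ((v i).2 - 1) = κ) :
    RightWinding v κ i := by
  refine ⟨fun _ d h1' h2' => ?_, fun h => ?_, fun h => ?_, fun h => ?_⟩
  · rw [← hw]
    exact eq_of_eq_pred (g := fun c => winding v c ((v i).2 - 1)) (fun e he he' =>
      hv.winding_along_horizontal (Or.inl hi) (Or.inr rfl) (by omega)) h1' h2' h1 h2
  all_goals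
    unfold Rightward at hi
    omega

theorem rightWinding_of_leftward (hv : IsHole v) {i : ZMod n} {κ : ℤ} (hi : Leftward v i)
    {c : ℤ} (h1 : (v (i + 1)).1 ≤ c) (h2 : c < (v i).1) (hw : winding v c (v i).2 = κ) :
    RightWinding v κ i := by
  refine ⟨fun h => ?_, fun _ d h1' h2' => ?_, fun h => ?_, fun h => ?_⟩
  rotate_left
  · rw [← hw]
    exact eq_of_eq_pred (g := fun c => winding v c (v i).2) (fun e he he' =>
      hv.winding_along_horizontal (Or.inr hi) (Or.inl rfl) (by omega)) h1' h2' h1 h2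
  all_goals
    unfold Leftward at hi
    omega

theorem rightWinding_of_upward (hv : IsHole v) {i : ZMod n} {κ : ℤ} (hi : Upward v i)
    {h : ℤ} (h1 : (v i).2 ≤ h) (h2 : h < (v (i + 1)).2) (hw : winding v (v i).1 h = κ) :
    RightWinding v κ i := by
  refine ⟨fun h => ?_, fun h => ?_, fun _ d h1' h2' => ?_, fun h => ?_⟩
  rotate_left 2
  · rw [← hw]
    exact eq_of_eq_pred (g := fun h => winding v (v i).1 h) (fun e he he' =>
      hv.winding_along_vertical (Or.inl hi) (Or.inl rfl) (by omega)) h1' h2' h1 h2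
  all_goals
    unfold Upward at hi
    omega

theorem rightWinding_of_downward (hv : IsHole v) {i : ZMod n} {κ : ℤ} (hi : Downward v i)
    {h : ℤ} (h1 : (v (i + 1)).2 ≤ h) (h2 : h < (v i).2) (hw : winding v ((v i).1 - 1) h = κ) :
    RightWinding v κ i := by
  refine ⟨fun h => ?_, fun h => ?_, fun h => ?_, fun _ d h1' h2' => ?_⟩
  rotate_left 3
  · rw [← hw]
    exact eq_of_eq_pred (g := fun h => winding v ((v i).1 - 1) h) (fun e he he' =>
      hv.winding_along_vertical (Or.inr hi) (Or.inr rfl) (by omega)) h1' h2' h1 h2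
  all_goals
    unfold Downward at hi
    omega

/-- Around a vertex the winding number changes only across the two edges that meet there. -/
theorem winding_row_eq_at_vertex (hv : IsHole v) {i : ZMod n} {c h : ℤ}
    (hh : h = (v (i + 1)).2) (hc : c = (v (i + 1)).1 ∨ c = (v (i + 1)).1 - 1)
    (h1 : ¬ Spans v i c) (h2 : ¬ Spans v (i + 1) c) :
    winding v c h = winding v c (h - 1) := by
  refine hv.winding_row_eq fun j hj hjc e1 e2 => ?_
  have hon : OnEdge v j (v (i + 1)).1 (v (i + 1)).2 := by
    rcases hc with rfl | rfl
    · rwa [← hh]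
    · rw [sub_add_cancel] at e2; rwa [← hh]
  have hsp : Spans v j c := by
    unfold OnEdge at e1 e2; unfold Horizontal Rightward Leftward at hj; unfold Spans; omega
  rcases hv.alternate i with ⟨hi, -⟩ | ⟨-, hi⟩
  · rw [hv.eq_of_horizontal (by unfold OnEdge; unfold Horizontal Rightward Leftward at hi; omega)
      hon hi hj] at hsp
    exact h1 hsp
  · rw [hv.eq_of_horizontal (by unfold OnEdge; unfold Horizontal Rightward Leftward at hi; omega)
      hon hi hj] at hsp
    exact h2 hsp

theorem winding_col_eq_at_vertex (hv : IsHole v) {i : ZMod n} {c h : ℤ}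
    (hc : c = (v (i + 1)).1) (hh : h = (v (i + 1)).2 ∨ h = (v (i + 1)).2 - 1)
    (h1 : ¬ SpansRow v i h) (h2 : ¬ SpansRow v (i + 1) h) :
    winding v c h = winding v (c - 1) h := by
  refine hv.winding_col_eq fun j hj hjc e1 e2 => ?_
  have hon : OnEdge v j (v (i + 1)).1 (v (i + 1)).2 := by
    rcases hh with rfl | rfl
    · rwa [← hc]
    · rw [sub_add_cancel] at e2; rwa [← hc]
  have hsp : SpansRow v j h := by
    unfold OnEdge at e1 e2; unfold Vertical Upward Downward at hj; unfold SpansRow; omega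
  rcases hv.alternate i with ⟨-, hi⟩ | ⟨hi, -⟩
  · rw [hv.eq_of_vertical (by unfold OnEdge; unfold Vertical Upward Downward at hi; omega)
      hon hi hj] at hsp
    exact h2 hsp
  · rw [hv.eq_of_vertical (by unfold OnEdge; unfold Vertical Upward Downward at hi; omega)
      hon hi hj] at hsp
    exact h1 hsp

theorem rightWinding_succ (hv : IsHole v) {i : ZMod n} {κ : ℤ} (h : RightWinding v κ i) :
    RightWinding v κ (i + 1) := by
  obtain ⟨hR, hL, hU, hD⟩ := h
  rcases hv.alternate i with ⟨hi | hi, hj | hj⟩ | ⟨hi | hi, hj | hj⟩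
  · have a := hR hi ((v (i + 1)).1 - 1) (by unfold Rightward at hi; omega) (by omega)
    unfold Rightward at hi
    have hj' := hj
    unfold Upward at hj'
    refine hv.rightWinding_of_upward hj le_rfl hj'.2 ?_
    rw [hv.winding_row_eq_at_vertex (i := i) rfl (Or.inl rfl) (by unfold Spans; omega)
      (by unfold Spans; omega), hv.winding_col_eq_at_vertex (i := i) rfl (Or.inr rfl)
      (by unfold SpansRow; omega) (by unfold SpansRow; omega), ← hi.1, a]
  · have a := hR hi ((v (i + 1)).1 - 1) (by unfold Rightward at hi; omega) (by omega)
    unfold Rightward at hi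
    have hj' := hj
    unfold Downward at hj'
    exact hv.rightWinding_of_downward hj (h := (v (i + 1)).2 - 1) (by omega) (by omega)
      (by rw [← hi.1, a])
  · have a := hL hi ((v (i + 1)).1) le_rfl hi.2
    unfold Leftward at hi
    have hj' := hj
    unfold Upward at hj'
    exact hv.rightWinding_of_upward hj le_rfl hj'.2 (by rw [← hi.1, a])
  · have a := hL hi ((v (i + 1)).1) le_rfl hi.2
    unfold Leftward at hi
    have hj' := hj
    unfold Downward at hj'
    refine hv.rightWinding_of_downward hj (h := (v (i + 1)).2 - 1) (by omega) (by omega) ?_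
    rw [← hv.winding_row_eq_at_vertex (i := i) rfl (Or.inr rfl) (by unfold Spans; omega)
      (by unfold Spans; omega), ← hv.winding_col_eq_at_vertex (i := i) rfl (Or.inl rfl)
      (by unfold SpansRow; omega) (by unfold SpansRow; omega), ← hi.1, a]
  · have a := hU hi ((v (i + 1)).2 - 1) (by unfold Upward at hi; omega) (by omega)
    unfold Upward at hi
    have hj' := hj
    unfold Rightward at hj'
    refine hv.rightWinding_of_rightward hj le_rfl hj'.2 ?_
    rw [← hi.1, a]
  · have a := hU hi ((v (i + 1)).2 - 1) (by unfold Upward at hi; omega) (by omega)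
    unfold Upward at hi
    have hj' := hj
    unfold Leftward at hj'
    refine hv.rightWinding_of_leftward hj (c := (v (i + 1)).1 - 1) (by omega) (by omega) ?_
    rw [← hv.winding_col_eq_at_vertex (i := i) rfl (Or.inl rfl)
      (by unfold SpansRow; omega) (by unfold SpansRow; omega),
      hv.winding_row_eq_at_vertex (i := i) rfl (Or.inl rfl) (by unfold Spans; omega)
      (by unfold Spans; omega), ← hi.1, a]
  · have a := hD hi ((v (i + 1)).2) le_rfl hi.2
    unfold Downward at hi
    have hj' := hj
    unfold Rightward at hj'
    refine hv.rightWinding_of_rightward hj le_rfl hj'.2 ?_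
    rw [hv.winding_col_eq_at_vertex (i := i) rfl (Or.inr rfl)
      (by unfold SpansRow; omega) (by unfold SpansRow; omega),
      ← hv.winding_row_eq_at_vertex (i := i) rfl (Or.inr rfl) (by unfold Spans; omega)
      (by unfold Spans; omega), ← hi.1, a]
  · have a := hD hi ((v (i + 1)).2) le_rfl hi.2
    unfold Downward at hi
    have hj' := hj
    unfold Leftward at hj'
    refine hv.rightWinding_of_leftward hj (c := (v (i + 1)).1 - 1) (by omega) (by omega) ?_
    rw [← hi.1, a]

theorem exists_rightWinding (hv : IsHole v) : ∃ κ, ∀ i, RightWinding v κ i := by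
  have h0 : ∃ κ, RightWinding v κ 0 := by
    rcases hv.horizontal_or_vertical 0 with (h | h) | (h | h)
    · exact ⟨_, hv.rightWinding_of_rightward h le_rfl h.2 rfl⟩
    · exact ⟨_, hv.rightWinding_of_leftward h le_rfl h.2 rfl⟩
    · exact ⟨_, hv.rightWinding_of_upward h le_rfl h.2 rfl⟩
    · exact ⟨_, hv.rightWinding_of_downward h le_rfl h.2 rfl⟩
  obtain ⟨κ, hκ⟩ := h0
  refine ⟨κ, fun i => ?_⟩
  have : ∀ k : ℕ, RightWinding v κ (k : ZMod n) := by
    intro k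
    induction k with
    | zero => simpa using hκ
    | succ k ih => simpa using hv.rightWinding_succ ih
  simpa using this i.val

end IsHole

namespace RightWinding

variable {n : ℕ} [NeZero n] {v : ZMod n → ℤ × ℤ} {κ : ℤ} {i : ZMod n}

theorem left_of_downward (h : RightWinding v κ i) (hv : IsHole v) (hi : Downward v i) {y : ℤ}
    (h1 : (v (i + 1)).2 ≤ y) (h2 : y < (v i).2) : winding v (v i).1 y = κ + 1 := by
  have := hv.winding_col (Or.inr hi) (Or.inr ⟨h1, h2⟩)
  rw [h.downward hi y h1 h2, if_pos h1, if_neg (by omega)] at this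
  omega

end RightWinding

/-! ## The part of the boundary between the leftmost and the rightmost edge -/

/-- A point on a part of the curve that runs to the right. -/
def OnRightwardPart {n : ℕ} (v : ZMod n → ℤ × ℤ) (x y : ℤ) : Prop :=
  ∃ i, OnEdge v i x y ∧ (Rightward v i ∨ Vertical v i ∧ Rightward v (i - 1) ∧ Rightward v (i + 1))

/-- A point on a part of the curve that runs to the left. -/
def OnLeftwardPart {n : ℕ} (v : ZMod n → ℤ × ℤ) (x y : ℤ) : Prop :=
  ∃ i, OnEdge v i x y ∧ (Leftward v i ∨ Vertical v i ∧ Leftward v (i - 1) ∧ Leftward v (i + 1))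

/-- `i` is a horizontal edge that the anticlockwise traversal reaches from `L` by running to the
right. -/
def LowerReach {n : ℕ} (v : ZMod n → ℤ × ℤ) (L i : ZMod n) : Prop :=
  ∃ a : ℕ, i = L + ((2 * a + 1 : ℕ) : ZMod n) ∧
    ∀ s ≤ a, Rightward v (L + ((2 * s + 1 : ℕ) : ZMod n))

/-- `j` is a horizontal edge from which the anticlockwise traversal reaches `L` by running to the
left. -/
def UpperReach {n : ℕ} (v : ZMod n → ℤ × ℤ) (L j : ZMod n) : Prop :=
  ∃ a : ℕ, j = L - ((2 * a + 1 : ℕ) : ZMod n) ∧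
    ∀ s ≤ a, Leftward v (L - ((2 * s + 1 : ℕ) : ZMod n))

theorem LowerReach.rightward {n : ℕ} {v : ZMod n → ℤ × ℤ} {L i : ZMod n}
    (h : LowerReach v L i) : Rightward v i := by
  obtain ⟨a, rfl, h⟩ := h
  exact h a le_rfl

theorem UpperReach.leftward {n : ℕ} {v : ZMod n → ℤ × ℤ} {L i : ZMod n}
    (h : UpperReach v L i) : Leftward v i := by
  obtain ⟨a, rfl, h⟩ := h
  exact h a le_rfl

theorem LowerReach.succ {n : ℕ} {v : ZMod n → ℤ × ℤ} {L i : ZMod n}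
    (h : LowerReach v L i) (hi : Rightward v (i + 1 + 1)) : LowerReach v L (i + 1 + 1) := by
  obtain ⟨a, rfl, h⟩ := h
  have e : L + ((2 * (a + 1) + 1 : ℕ) : ZMod n) = L + ((2 * a + 1 : ℕ) : ZMod n) + 1 + 1 := by
    push_cast; ring
  refine ⟨a + 1, e.symm, fun s hs => ?_⟩
  rcases Nat.lt_or_ge a s with hs' | hs'
  · obtain rfl : s = a + 1 := by omega
    rwa [e]
  · exact h s hs'

theorem UpperReach.pred {n : ℕ} {v : ZMod n → ℤ × ℤ} {L j : ZMod n}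
    (h : UpperReach v L (j + 1 + 1)) (hj : Leftward v j) : UpperReach v L j := by
  obtain ⟨a, ha, h⟩ := h
  have e : L - ((2 * (a + 1) + 1 : ℕ) : ZMod n) = j := by
    rw [← sub_eq_zero] at ha ⊢
    push_cast at ha ⊢
    linear_combination -ha
  refine ⟨a + 1, e.symm, fun s hs => ?_⟩
  rcases Nat.lt_or_ge a s with hs' | hs'
  · obtain rfl : s = a + 1 := by omega
    rwa [e]
  · exact h s hs'

/-- Over the unit interval that starts at `c`, the lower edge `i` and the upper edge `j` bound a
vertical strip of the inside. -/
structure Strip {n : ℕ} [NeZero n] (v : ZMod n → ℤ × ℤ) (L : ZMod n) (κ c : ℤ) (i j : ZMod n) :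
    Prop where
  lower : LowerReach v L i
  upper : UpperReach v L j
  lower_le : (v i).1 ≤ c
  lt_lower : c < (v (i + 1)).1
  upper_le : (v (j + 1)).1 ≤ c
  lt_upper : c < (v j).1
  lt : (v i).2 < (v j).2
  inside : ∀ h, (v i).2 ≤ h → h < (v j).2 → winding v c h = κ + 1

namespace IsHole

variable {n : ℕ} {v : ZMod n → ℤ × ℤ}

theorem not_leftward_of_rightward {i : ZMod n} (h : Rightward v i) : ¬ Leftward v i := by
  unfold Rightward Leftward at *; omega

theorem not_onRightwardPart_and_onLeftwardPart (hv : IsHole v) {x y : ℤ}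
    (h₁ : OnRightwardPart v x y) (h₂ : OnLeftwardPart v x y) : False := by
  obtain ⟨i, hi, hi'⟩ := h₁
  obtain ⟨j, hj, hj'⟩ := h₂
  have k1 : ∀ i, Rightward v i → Leftward v i → False := fun i h h' =>
    not_leftward_of_rightward h h'
  have k2 : ∀ i, Rightward v i → Vertical v i → False := fun i h h' =>
    not_horizontal_of_vertical h' (Or.inl h)
  have k3 : ∀ i, Leftward v i → Vertical v i → False := fun i h h' =>
    not_horizontal_of_vertical h' (Or.inr h)
  have k4 : ∀ i, Rightward v i → Leftward v (i + 1) → False := fun i h h' =>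
    hv.not_horizontal_succ (Or.inl h) (Or.inr h')
  have k5 : ∀ i, Leftward v i → Rightward v (i + 1) → False := fun i h h' =>
    hv.not_horizontal_succ (Or.inr h) (Or.inl h')
  have k6 : ∀ i, Vertical v i → Vertical v (i + 1) → False := fun i h h' =>
    hv.not_vertical_succ h h'
  rcases hv.eq_or_adjacent hi hj with rfl | rfl | rfl <;>
  rcases hi' with hi' | ⟨hi', hi1, hi2⟩ <;> rcases hj' with hj' | ⟨hj', hj1, hj2⟩ <;>
    (try simp only [add_sub_cancel_right] at *) <;> grind

theorem vertical_of_horizontal_pred (hv : IsHole v) {i : ZMod n} (h : Horizontal v (i + 1)) :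
    Vertical v i := by
  rcases hv.horizontal_or_vertical i with h' | h'
  · exact absurd h (hv.not_horizontal_succ h')
  · exact h'

variable [NeZero n] {κ : ℤ} {L : ZMod n}

/-- A strip is closed on the right only by a vertical edge that joins its two edges. -/
theorem strip_lower (hv : IsHole v) (hL : ∀ i, ¬ IsLeftNotch v i) (hκ : ∀ i, RightWinding v κ i)
    {c : ℤ} {i j : ZMod n} (T : Strip v L κ c i j) :
    i + 1 + 1 = j ∨ ∃ i', LowerReach v L i' ∧ (v i').1 ≤ c + 1 ∧ c + 1 < (v (i' + 1)).1 ∧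
      (∀ h, ((v i).2 ≤ h ∧ h ≤ (v i').2 ∨ (v i').2 ≤ h ∧ h ≤ (v i).2) →
        OnRightwardPart v (c + 1) h) ∧
      (∀ h, (v i').2 ≤ h → h < (v i).2 → winding v (c + 1) h = κ + 1) ∧
      ((v (i + 1)).1 = c + 1 → (v i').2 = (v (i + 1 + 1)).2) := by
  have hi := T.lower.rightward
  have hj := T.upper.leftward
  have hi' := hi
  have hj' := hj
  obtain ⟨t1, t2, t3, t4, t5, t6, t7, t8⟩ := T
  unfold Rightward at hi'
  unfold Leftward at hj'
  rcases (show c + 1 < (v (i + 1)).1 ∨ (v (i + 1)).1 = c + 1 by omega) with h | h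
  · refine Or.inr ⟨i, t1, by omega, h, fun y hy => ⟨i, ?_, Or.inl hi⟩, by omega, by omega⟩
    unfold OnEdge; omega
  have hV := hv.vertical_succ (Or.inl hi)
  have hV' := hV
  unfold Vertical Upward Downward at hV'
  rcases hv.horizontal_succ hV with h2 | h2
  · have h2' := h2
    unfold Rightward at h2'
    refine Or.inr ⟨i + 1 + 1, t1.succ h2, by omega, by omega, fun y hy => ⟨i + 1, ?_, Or.inr
      ⟨hV, by simpa using hi, h2⟩⟩, fun y h3 h4 => ?_, fun _ => rfl⟩
    · unfold OnEdge; omega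
    · have hD : Downward v (i + 1) := by unfold Downward; omega
      have := (hκ _).left_of_downward hv hD h3 (by omega)
      rwa [h] at this
  · left
    have hU : Upward v (i + 1) := by
      rcases hV with hU | hD
      · exact hU
      · exact absurd ⟨by simpa using hi, hD, h2⟩ (hL (i + 1))
    have h2' := h2
    unfold Leftward at h2'
    unfold Upward at hU
    rcases lt_or_ge (v (i + 1 + 1)).2 (v j).2 with h3 | h3
    · have w1 := (hκ _).leftward h2 c (by omega) (by omega)
      have w2 := t8 (v (i + 1 + 1)).2 (by omega) h3
      omega
    · have e1 : OnEdge v j (c + 1) (v j).2 := by unfold OnEdge; omega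
      have e2 : OnEdge v (i + 1) (c + 1) (v j).2 := by unfold OnEdge; omega
      rcases hv.adjacent_of_horizontal_of_vertical e1 e2 (Or.inr hj) hV with h4 | h4
      · rw [add_right_cancel h4] at hi
        exact absurd hj (not_leftward_of_rightward hi)
      · exact h4.symm

theorem strip_upper (hv : IsHole v) (hL : ∀ i, ¬ IsLeftNotch v i) (hκ : ∀ i, RightWinding v κ i)
    {c : ℤ} {i j : ZMod n} (T : Strip v L κ c i j) :
    i + 1 + 1 = j ∨ ∃ j', UpperReach v L j' ∧ (v (j' + 1)).1 ≤ c + 1 ∧ c + 1 < (v j').1 ∧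
      (∀ h, ((v j).2 ≤ h ∧ h ≤ (v j').2 ∨ (v j').2 ≤ h ∧ h ≤ (v j).2) →
        OnLeftwardPart v (c + 1) h) ∧
      (∀ h, (v j).2 ≤ h → h < (v j').2 → winding v (c + 1) h = κ + 1) ∧
      ((v j).1 = c + 1 → (v j').2 = (v (j - 1)).2) := by
  have hi := T.lower.rightward
  have hj := T.upper.leftward
  have hi' := hi
  have hj' := hj
  obtain ⟨t1, t2, t3, t4, t5, t6, t7, t8⟩ := T
  unfold Rightward at hi'
  unfold Leftward at hj'
  rcases (show c + 1 < (v j).1 ∨ (v j).1 = c + 1 by omega) with h | h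
  · refine Or.inr ⟨j, t2, by omega, h, fun y hy => ⟨j, ?_, Or.inl hj⟩, by omega, by omega⟩
    unfold OnEdge; omega
  obtain ⟨k, rfl⟩ : ∃ k, j = k + 1 + 1 := ⟨j - 1 - 1, by ring⟩
  have hV := hv.vertical_of_horizontal_pred (Or.inr hj)
  have hV' := hV
  unfold Vertical Upward Downward at hV'
  rw [add_sub_cancel_right]
  have hH : Horizontal v k := by
    rcases hv.horizontal_or_vertical k with h' | h'
    · exact h'
    · exact absurd hV (hv.not_vertical_succ h')
  rcases hH with h2 | h2
  · left
    have hU : Upward v (k + 1) := by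
      rcases hV with hU | hD
      · exact hU
      · exact absurd ⟨by simpa using h2, hD, hj⟩ (hL (k + 1))
    have h2' := h2
    unfold Rightward at h2'
    unfold Upward at hU
    rcases lt_or_ge (v i).2 (v (k + 1)).2 with h3 | h3
    · have w1 := (hκ _).rightward h2 c (by omega) (by omega)
      have w2 := t8 ((v k).2 - 1) (by omega) (by omega)
      omega
    · have e1 : OnEdge v i (c + 1) (v i).2 := by unfold OnEdge; omega
      have e2 : OnEdge v (k + 1) (c + 1) (v i).2 := by unfold OnEdge; omega
      rcases hv.adjacent_of_horizontal_of_vertical e1 e2 (Or.inl hi) hV with h4 | h4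
      · rw [h4]
      · rw [h4] at hi
        exact absurd hj (not_leftward_of_rightward hi)
  · have h2' := h2
    unfold Leftward at h2'
    refine Or.inr ⟨k, t2.pred h2, by omega, by omega, fun y hy => ⟨k + 1, ?_, Or.inr
      ⟨hV, by simpa using h2, hj⟩⟩, fun y h3 h4 => ?_, fun _ => h2'.1⟩
    · unfold OnEdge; omega
    · have hD : Downward v (k + 1) := by unfold Downward; omega
      have := (hκ _).left_of_downward hv hD h3 (by omega)
      rwa [show (v (k + 1)).1 = c + 1 by omega] at this

theorem strip_succ (hv : IsHole v) (hL : ∀ i, ¬ IsLeftNotch v i) (hR : ∀ i, ¬ IsRightNotch v i)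
    (hκ : ∀ i, RightWinding v κ i) {c : ℤ} {i j : ZMod n} (T : Strip v L κ c i j) :
    i + 1 + 1 = j ∨ ∃ i' j', Strip v L κ (c + 1) i' j' := by
  rcases hv.strip_lower hL hκ T with h | ⟨i', a1, a2, a3, a4, a5, a6⟩
  · exact Or.inl h
  rcases hv.strip_upper hL hκ T with h | ⟨j', b1, b2, b3, b4, b5, b6⟩
  · exact Or.inl h
  have hi := T.lower.rightward
  have hj := T.upper.leftward
  have hi' := hi
  have hj' := hj
  obtain ⟨t1, t2, t3, t4, t5, t6, t7, t8⟩ := T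
  unfold Rightward at hi'
  unfold Leftward at hj'
  have hsep : ∀ y, ¬ (((v i).2 ≤ y ∧ y ≤ (v i').2 ∨ (v i').2 ≤ y ∧ y ≤ (v i).2) ∧
      ((v j).2 ≤ y ∧ y ≤ (v j').2 ∨ (v j').2 ≤ y ∧ y ≤ (v j).2)) :=
    fun y ⟨h, h'⟩ => hv.not_onRightwardPart_and_onLeftwardPart (a4 y h) (b4 y h')
  have s1 := hsep (v i).2
  have s2 := hsep (v i').2
  have s3 := hsep (v j).2
  have s4 := hsep (v j').2
  refine Or.inr ⟨i', j', a1, b1, a2, a3, b2, b3, by omega, fun y h1 h2 => ?_⟩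
  rcases lt_or_ge y (v i).2 with h3 | h3
  · exact a5 y h1 h3
  rcases lt_or_ge y (v j).2 with h4 | h4
  swap
  · exact b5 y h4 h2
  have w := t8 y h3 h4
  rw [hv.winding_col_eq (c := c + 1) (h := y), add_sub_cancel_right, w]
  intro g hg hgx e1 e2
  have hg' := hg
  unfold Vertical Upward Downward at hg'
  unfold OnEdge at e1 e2
  have hU : Upward v g := by
    rcases hg with hU | hD
    · exact hU
    · have := (hκ g).downward hD y (by unfold Downward at hD; omega)
        (by unfold Downward at hD; omega)
      rw [hgx, add_sub_cancel_right] at this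
      omega
  have hU' := hU
  unfold Upward at hU'
  obtain ⟨k, rfl⟩ : ∃ k, g = k + 1 := ⟨g - 1, by ring⟩
  have hleft : Rightward v k ∨ Leftward v (k + 1 + 1) := by
    by_contra! hcon
    have hk : Horizontal v k := by
      rcases hv.horizontal_or_vertical k with h' | h'
      · exact h'
      · exact absurd hg (hv.not_vertical_succ h')
    rcases hk with hk | hk
    · exact hcon.1 hk
    rcases hv.horizontal_succ hg with hk' | hk'
    · exact hR (k + 1) ⟨by simpa using hk, hU, hk'⟩
    · exact hcon.2 hk'
  rcases hleft with hk | hk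
  · have hk' := hk
    unfold Rightward at hk'
    rcases lt_or_ge (v i).2 (v k).2 with h5 | h5
    · have w1 := (hκ _).rightward hk c (by omega) (by omega)
      have w2 := t8 ((v k).2 - 1) (by omega) (by omega)
      omega
    · have f1 : OnEdge v i (c + 1) (v i).2 := by unfold OnEdge; omega
      have f2 : OnEdge v (k + 1) (c + 1) (v i).2 := by unfold OnEdge; omega
      rcases hv.adjacent_of_horizontal_of_vertical f1 f2 (Or.inl hi) hg with h6 | h6
      · obtain rfl := add_right_cancel h6
        have := a6 hgx
        omega
      · rw [h6] at t3 hi' h3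
        omega
  · have hk' := hk
    unfold Leftward at hk'
    rcases lt_or_ge (v (k + 1 + 1)).2 (v j).2 with h5 | h5
    · have w1 := (hκ _).leftward hk c (by omega) (by omega)
      have w2 := t8 (v (k + 1 + 1)).2 (by omega) h5
      omega
    · have f1 : OnEdge v j (c + 1) (v j).2 := by unfold OnEdge; omega
      have f2 : OnEdge v (k + 1) (c + 1) (v j).2 := by unfold OnEdge; omega
      rcases hv.adjacent_of_horizontal_of_vertical f1 f2 (Or.inr hj) hg with h6 | h6
      · rw [← h6] at hj'
        omega
      · subst h6
        have := b6 (by omega)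
        rw [add_sub_cancel_right] at this
        omega

/-- From the leftmost edge the anticlockwise traversal runs only to the right until it reaches the
rightmost edge. -/
theorem exists_rightward_between (hv : IsHole v) (hLN : ∀ i, ¬ IsLeftNotch v i)
    (hRN : ∀ i, ¬ IsRightNotch v i) {R : ZMod n} (hL : IsLeftmostEdge v L)
    (hR : IsRightmostEdge v R) :
    ∃ m : ℕ, 1 ≤ m ∧ (R - L).val = 2 * m ∧
      ∀ s < m, Rightward v (L + ((2 * s + 1 : ℕ) : ZMod n)) := by
  obtain ⟨κ, hκ⟩ := hv.exists_rightWinding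
  obtain ⟨l1, l2, l3⟩ := hL
  obtain ⟨r1, r2, r3⟩ := hR
  have l1' := l1
  have l2' := l2
  have l3' := l3
  unfold Leftward at l1'
  unfold Downward at l2'
  unfold Rightward at l3'
  rw [sub_add_cancel] at l1'
  have base : Strip v L κ (v L).1 (L + 1) (L - 1) := by
    refine ⟨⟨0, by simp, fun s hs => ?_⟩, ⟨0, by simp, fun s hs => ?_⟩, by omega, by omega,
      by rw [sub_add_cancel], by omega, by omega, fun y h1 h2 => ?_⟩
    · obtain rfl : s = 0 := by omega
      simpa using l3
    · obtain rfl : s = 0 := by omega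
      simpa using l1
    · exact (hκ L).left_of_downward hv l2 h1 (by omega)
  have hclosed : ∃ i, LowerReach v L i ∧ UpperReach v L (i + 1 + 1) := by
    by_contra hcon
    have hall : ∀ k : ℕ, ∃ i j, Strip v L κ ((v L).1 + k) i j := by
      intro k
      induction k with
      | zero => exact ⟨_, _, by simpa using base⟩
      | succ k ih =>
        obtain ⟨i, j, T⟩ := ih
        rcases hv.strip_succ hLN hRN hκ T with h | ⟨i', j', T'⟩
        · exact absurd ⟨i, T.lower, h ▸ T.upper⟩ hcon
        · exact ⟨i', j', by push_cast; rw [← add_assoc]; exact T'⟩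
    obtain ⟨B, hB⟩ : ∃ B : ℤ, ∀ i, (v i).1 ≤ B := by
      obtain ⟨B, hB⟩ := (Set.finite_range fun i => (v i).1).bddAbove
      exact ⟨B, fun i => hB ⟨i, rfl⟩⟩
    obtain ⟨i, j, T⟩ := hall (B - (v L).1).toNat
    have h1 := T.lt_lower
    have h2 := hB (i + 1)
    omega
  obtain ⟨i, ⟨a, ha, ha'⟩, b, hb, hb'⟩ := hclosed
  have hodd : ∀ k : ℕ, Vertical v (L + ((2 * k : ℕ) : ZMod n)) ∧
      Horizontal v (L + ((2 * k + 1 : ℕ) : ZMod n)) := by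
    intro k
    induction k with
    | zero => exact ⟨Or.inr (by simpa using l2), Or.inl (by simpa using l3)⟩
    | succ k ih =>
      have e1 : L + ((2 * (k + 1) : ℕ) : ZMod n) = L + ((2 * k + 1 : ℕ) : ZMod n) + 1 := by
        push_cast; ring
      have e2 : L + ((2 * (k + 1) + 1 : ℕ) : ZMod n) =
        L + ((2 * k + 1 : ℕ) : ZMod n) + 1 + 1 := by push_cast; ring
      have := hv.vertical_succ ih.2
      rw [e1, e2]
      exact ⟨this, hv.horizontal_succ this⟩
  have hRL : R = L + ((R - L).val : ZMod n) := by simp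
  have hlt : (R - L).val < n := ZMod.val_lt _
  have hsum : ((2 * a + 2 * b + 4 : ℕ) : ZMod n) = 0 := by
    rw [ha] at hb
    push_cast at hb ⊢
    linear_combination hb
  have hle : n ≤ 2 * a + 2 * b + 4 :=
    Nat.le_of_dvd (by omega) ((ZMod.natCast_eq_zero_iff _ _).1 hsum)
  obtain ⟨k, hk | hk⟩ := Nat.even_or_odd' (R - L).val
  swap
  · rw [hk] at hRL
    exact absurd (hRL ▸ (hodd k).2) (not_horizontal_of_vertical (Or.inl r2))
  rw [hk] at hRL
  rcases Nat.lt_or_ge a k with h1 | h1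
  swap
  · have := ha' k h1
    have e : L + ((2 * k + 1 : ℕ) : ZMod n) = R + 1 := by rw [hRL]; push_cast; ring
    rw [e] at this
    exact absurd r3 (not_leftward_of_rightward this)
  rcases Nat.lt_or_ge (a + 1) k with h2 | h2
  · have := hb' (a + b + 2 - k) (by omega)
    have e : L - ((2 * (a + b + 2 - k) + 1 : ℕ) : ZMod n) = R - 1 := by
      rw [hRL]
      have e2 : 2 * (a + b + 2 - k) + 1 + 2 * k = 2 * a + 2 * b + 4 + 1 := by omega
      have e3 : ((2 * (a + b + 2 - k) + 1 : ℕ) : ZMod n) + ((2 * k : ℕ) : ZMod n) = 1 := by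
        rw [← Nat.cast_add, e2, Nat.cast_add, hsum]; simp
      linear_combination -e3
    rw [e] at this
    exact absurd this (not_leftward_of_rightward r1)
  · exact ⟨k, by omega, hk, fun s hs => ha' s (by omega)⟩

end IsHole

/-! ## Coordinates of the lower boundary -/

/-- Abscissa of the left vertex of the `s`-th horizontal edge after `L`. -/
def chainX {n : ℕ} (v : ZMod n → ℤ × ℤ) (L : ZMod n) (s : ℕ) : ℤ :=
  (v (L + ((2 * s + 1 : ℕ) : ZMod n))).1

/-- Height of the `s`-th horizontal edge after `L`. -/
def chainY {n : ℕ} (v : ZMod n → ℤ × ℤ) (L : ZMod n) (s : ℕ) : ℤ :=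
  (v (L + ((2 * s + 1 : ℕ) : ZMod n))).2

/-- The anticlockwise traversal runs only to the right between `L` and `R`, along `m` horizontal
edges. -/
structure IsLowerChain {n : ℕ} (v : ZMod n → ℤ × ℤ) (L R : ZMod n) (m : ℕ) : Prop where
  one_le : 1 ≤ m
  val_sub : (R - L).val = 2 * m
  leftmost : IsLeftmostEdge v L
  rightmost : IsRightmostEdge v R
  vertical : ∀ s ≤ m, Vertical v (L + ((2 * s : ℕ) : ZMod n))
  rightward : ∀ s < m, Rightward v (L + ((2 * s + 1 : ℕ) : ZMod n))

theorem IsNiceHole.exists_isLowerChain {n : ℕ} [NeZero n] {v : ZMod n → ℤ × ℤ} {L R : ZMod n}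
    (hv : IsNiceHole v) (hL : IsLeftmostEdge v L) (hR : IsRightmostEdge v R) :
    ∃ m, IsLowerChain v L R m := by
  obtain ⟨m, h1, h2, h3⟩ :=
    hv.toIsHole.exists_rightward_between hv.no_left_notch hv.no_right_notch hL hR
  refine ⟨m, h1, h2, hL, hR, fun s hs => ?_, h3⟩
  cases s with
  | zero => exact Or.inr (by simpa using hL.2.1)
  | succ s =>
    have := hv.toIsHole.vertical_succ (Or.inl (h3 s hs))
    rwa [show L + ((2 * s + 1 : ℕ) : ZMod n) + 1 = L + ((2 * (s + 1) : ℕ) : ZMod n) by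
      push_cast; ring] at this

namespace IsLowerChain

variable {n : ℕ} {v : ZMod n → ℤ × ℤ} {L R : ZMod n} {m : ℕ}

theorem eq_left (v : ZMod n → ℤ × ℤ) (L : ZMod n) (s : ℕ) : v (L + ((2 * s + 1 : ℕ) : ZMod n)) = (chainX v L s, chainY v L s) := rfl

theorem even_succ (s : ℕ) : L + ((2 * s : ℕ) : ZMod n) + 1 = L + ((2 * s + 1 : ℕ) : ZMod n) := by
  push_cast; ring

theorem odd_succ (s : ℕ) :
    L + ((2 * s + 1 : ℕ) : ZMod n) + 1 = L + ((2 * (s + 1) : ℕ) : ZMod n) := by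
  push_cast; ring

theorem eq_right (h : IsLowerChain v L R m) {s : ℕ} (hs : s < m) :
    v (L + ((2 * (s + 1) : ℕ) : ZMod n)) = (chainX v L (s + 1), chainY v L s) := by
  have h1 := h.vertical (s + 1) hs
  have h2 := h.rightward s hs
  unfold Rightward at h2
  unfold Vertical Upward Downward at h1
  rw [odd_succ] at h2
  rw [even_succ] at h1
  refine Prod.ext ?_ h2.1.symm
  change _ = (v _).1
  omega

theorem X_lt (h : IsLowerChain v L R m) {s : ℕ} (hs : s < m) :
    chainX v L s < chainX v L (s + 1) := by
  have h2 := (h.rightward s hs).2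
  rw [odd_succ, h.eq_right hs] at h2
  exact h2

theorem X_le_of_le (h : IsLowerChain v L R m) {s t : ℕ} (hst : s ≤ t) (ht : t ≤ m) :
    chainX v L s ≤ chainX v L t := by
  induction t, hst using Nat.le_induction with
  | base => exact le_rfl
  | succ t hst ih => exact (ih (by omega)).trans (h.X_lt (by omega)).le

theorem lt_of_X_lt (h : IsLowerChain v L R m) {s t : ℕ} (hs : s ≤ m)
    (hst : chainX v L s < chainX v L t) : s < t := by
  by_contra! hc
  have := h.X_le_of_le hc hs
  omega

theorem lower_L (h : IsLowerChain v L R m) : lower v L = (chainX v L 0, chainY v L 0) := by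
  have h2 := h.leftmost.2.1.2
  unfold lower
  rw [if_pos h2.le]
  simp [chainX, chainY]

theorem X_L (h : IsLowerChain v L R m) : (v L).1 = chainX v L 0 := by
  rw [h.leftmost.2.1.1]
  simp [chainX]

variable [NeZero n]

theorem eq_R (h : IsLowerChain v L R m) : R = L + ((2 * m : ℕ) : ZMod n) := by
  rw [← h.val_sub]; simp

theorem two_mul_lt (h : IsLowerChain v L R m) : 2 * m < n := by
  rw [← h.val_sub]; exact ZMod.val_lt _

theorem eq_at_R (h : IsLowerChain v L R m) : v R = (chainX v L m, chainY v L (m - 1)) := by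
  have := h.one_le
  have := h.eq_right (s := m - 1) (by omega)
  rwa [Nat.sub_add_cancel (by omega), ← h.eq_R] at this

theorem lower_R (h : IsLowerChain v L R m) :
    lower v R = (chainX v L m, chainY v L (m - 1)) := by
  have h2 := h.rightmost.2.1.2
  unfold lower
  rw [if_neg (by omega), h.eq_at_R]

theorem X_R (h : IsLowerChain v L R m) : (v R).1 = chainX v L m := by rw [h.eq_at_R]

theorem Y_le_yMax (s : ℕ) : chainY v L s ≤ yMax v :=
  Finset.le_sup' (fun i => (v i).2) (Finset.mem_univ _)

/-! ## The region above the lower boundary -/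

/-- The points between the lower boundary and the height `yMax`. -/
def region (v : ZMod n → ℤ × ℤ) (L : ZMod n) (m : ℕ) : Set (ℝ × ℝ) :=
  ⋃ s ∈ Set.Iio m, Icc (chainX v L s : ℝ) (chainX v L (s + 1)) ×ˢ Icc (chainY v L s : ℝ) (yMax v)

theorem mem_region {q : ℝ × ℝ} : q ∈ region v L m ↔
    ∃ s < m, ((chainX v L s : ℝ) ≤ q.1 ∧ q.1 ≤ chainX v L (s + 1)) ∧
      (chainY v L s : ℝ) ≤ q.2 ∧ q.2 ≤ yMax v := by
  simp only [region, Set.mem_iUnion, Set.mem_Iio, Set.mem_prod, Set.mem_Icc, exists_prop]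

theorem isClosed_region : IsClosed (region v L m) :=
  (Set.finite_Iio m).isClosed_biUnion fun _ _ => isClosed_Icc.prod isClosed_Icc

theorem isBounded_region : Bornology.IsBounded (region v L m) :=
  (Bornology.isBounded_biUnion (Set.finite_Iio m)).2 fun _ _ =>
    (Metric.isBounded_Icc _ _).prod (Metric.isBounded_Icc _ _)

omit [NeZero n] in
theorem exists_edge_right {x : ℝ} (h0 : (chainX v L 0 : ℝ) ≤ x) (hm : x < chainX v L m) :
    ∃ s < m, (chainX v L s : ℝ) ≤ x ∧ x < chainX v L (s + 1) := by
  induction m with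
  | zero => exact absurd hm (not_lt.2 h0)
  | succ m ih =>
    rcases lt_or_ge x (chainX v L m) with h | h
    · obtain ⟨s, hs, h'⟩ := ih h
      exact ⟨s, by omega, h'⟩
    · exact ⟨m, by omega, h, hm⟩

omit [NeZero n] in
theorem exists_edge_left {x : ℝ} (h0 : (chainX v L 0 : ℝ) < x) (hm : x ≤ chainX v L m) :
    ∃ s < m, (chainX v L s : ℝ) < x ∧ x ≤ chainX v L (s + 1) := by
  induction m with
  | zero => exact absurd h0 (not_lt.2 hm)
  | succ m ih =>
    rcases le_or_gt x (chainX v L m) with h | h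
    · obtain ⟨s, hs, h'⟩ := ih h
      exact ⟨s, by omega, h'⟩
    · exact ⟨m, by omega, h, hm⟩

omit [NeZero n] in
theorem edgeSet_odd (h : IsLowerChain v L R m) {s : ℕ} (hs : s < m) :
    edgeSet v (L + ((2 * s + 1 : ℕ) : ZMod n)) =
      {q : ℝ × ℝ | q.1 ∈ Set.uIcc (chainX v L s : ℝ) (chainX v L (s + 1)) ∧ q.2 = chainY v L s} := by
  rw [edgeSet, odd_succ, h.eq_right hs, eq_left v L]
  exact segment_horizontal _ _ _

omit [NeZero n] in
theorem edgeSet_even (h : IsLowerChain v L R m) {s : ℕ} (hs : s < m) :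
    edgeSet v (L + ((2 * (s + 1) : ℕ) : ZMod n)) =
      {q : ℝ × ℝ | q.1 = chainX v L (s + 1) ∧
        q.2 ∈ Set.uIcc (chainY v L s : ℝ) (chainY v L (s + 1))} := by
  rw [edgeSet, even_succ, h.eq_right (by omega), eq_left v L]
  exact segment_vertical _ _ _

theorem mem_botBoundary (h : IsLowerChain v L R m) {q : ℝ × ℝ} : q ∈ botBoundary v L R ↔
    (∃ s < m, ((chainX v L s : ℝ) ≤ q.1 ∧ q.1 ≤ chainX v L (s + 1)) ∧ q.2 = chainY v L s) ∨
    (∃ s, s + 1 < m ∧ q.1 = chainX v L (s + 1) ∧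
      q.2 ∈ Set.uIcc (chainY v L s : ℝ) (chainY v L (s + 1))) ∨
    (q.1 = chainX v L 0 ∧ (chainY v L 0 : ℝ) ≤ q.2 ∧ q.2 ≤ yMax v) ∨
    (((chainX v L 0 : ℝ) ≤ q.1 ∧ q.1 ≤ chainX v L m) ∧ q.2 = yMax v) ∨
    (q.1 = chainX v L m ∧ (chainY v L (m - 1) : ℝ) ≤ q.2 ∧ q.2 ≤ yMax v) := by
  have hle : ∀ s, (chainY v L s : ℝ) ≤ yMax v := fun s => by exact_mod_cast Y_le_yMax s
  have hX : (chainX v L 0 : ℝ) ≤ chainX v L m := by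
    exact_mod_cast h.X_le_of_le (Nat.zero_le m) le_rfl
  unfold botBoundary
  rw [h.lower_L, h.lower_R, h.X_L, h.X_R]
  unfold toPlane
  dsimp only
  rw [segment_vertical, segment_vertical, segment_horizontal, Set.uIcc_of_le (hle _),
    Set.uIcc_of_ge (hle _), Set.uIcc_of_le hX]
  simp only [Set.mem_union, Set.mem_ofPred_eq, Set.mem_Icc, or_assoc]
  have hlow : q ∈ lowerBoundary v L R ↔
      (∃ s < m, ((chainX v L s : ℝ) ≤ q.1 ∧ q.1 ≤ chainX v L (s + 1)) ∧ q.2 = chainY v L s) ∨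
      (∃ s, s + 1 < m ∧ q.1 = chainX v L (s + 1) ∧
        q.2 ∈ Set.uIcc (chainY v L s : ℝ) (chainY v L (s + 1))) := by
    have hXs : ∀ s < m, (chainX v L s : ℝ) ≤ chainX v L (s + 1) := fun s hs => by
      exact_mod_cast (h.X_lt hs).le
    unfold lowerBoundary
    rw [h.val_sub]
    constructor
    · rintro ⟨k, hk1, hk2, hq⟩
      obtain ⟨s, rfl | rfl⟩ := Nat.even_or_odd' k
      · right
        obtain ⟨s, rfl⟩ : ∃ t, s = t + 1 := ⟨s - 1, by omega⟩
        rw [h.edgeSet_even (by omega)] at hq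
        exact ⟨s, by omega, hq⟩
      · left
        rw [h.edgeSet_odd (by omega)] at hq
        refine ⟨s, by omega, ?_, hq.2⟩
        have := hq.1
        rwa [Set.uIcc_of_le (hXs s (by omega)), Set.mem_Icc] at this
    · rintro (⟨s, hs, h1, h2⟩ | ⟨s, hs, h1⟩)
      · refine ⟨2 * s + 1, by omega, by omega, ?_⟩
        rw [h.edgeSet_odd hs]
        exact ⟨by rwa [Set.uIcc_of_le (hXs s (by omega)), Set.mem_Icc], h2⟩
      · refine ⟨2 * (s + 1), by omega, by omega, ?_⟩
        rw [h.edgeSet_even (by omega)]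
        exact h1
  rw [hlow, or_assoc]

theorem botBoundary_subset (h : IsLowerChain v L R m) : botBoundary v L R ⊆ region v L m := by
  intro q hq
  have hle : ∀ s, (chainY v L s : ℝ) ≤ yMax v := fun s => by exact_mod_cast Y_le_yMax s
  have hX : ∀ s < m, (chainX v L s : ℝ) ≤ chainX v L (s + 1) := fun s hs => by
    exact_mod_cast (h.X_lt hs).le
  have hm := h.one_le
  rw [mem_region]
  rcases h.mem_botBoundary.1 hq with ⟨s, hs, h1, h2⟩ | ⟨s, hs, h1, h2⟩ | ⟨h1, h2⟩ | ⟨⟨h1, h1'⟩, h2⟩ |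
    ⟨h1, h2⟩
  · exact ⟨s, hs, h1, h2.ge, h2 ▸ hle s⟩
  · rcases Set.mem_uIcc.1 h2 with h3 | h3
    · exact ⟨s, by omega, ⟨by rw [h1]; exact hX s (by omega), h1.le⟩, h3.1, h3.2.trans (hle _)⟩
    · exact ⟨s + 1, hs, ⟨h1.ge, by rw [h1]; exact hX _ hs⟩, h3.1, h3.2.trans (hle _)⟩
  · exact ⟨0, hm, ⟨h1.ge, by rw [h1]; exact hX 0 hm⟩, h2⟩
  · rcases h1.eq_or_lt with h3 | h3
    · exact ⟨0, hm, ⟨h1, by rw [← h3]; exact hX 0 hm⟩, h2 ▸ hle 0, h2.le⟩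
    · obtain ⟨s, hs, h4, h5⟩ := exists_edge_left h3 h1'
      exact ⟨s, hs, ⟨h4.le, h5⟩, h2 ▸ hle s, h2.le⟩
  · have e : m - 1 + 1 = m := by omega
    have := hX (m - 1) (by omega)
    rw [e] at this
    exact ⟨m - 1, by omega, ⟨by rwa [h1], by rw [e]; exact h1.le⟩, h2⟩

theorem isClosed_botBoundary (v : ZMod n → ℤ × ℤ) (L R : ZMod n) :
    IsClosed (botBoundary v L R) := by
  have hseg : ∀ a b : ℝ × ℝ, IsClosed (segment ℝ a b) := fun a b => by
    rw [← convexHull_pair (𝕜 := ℝ)]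
    exact ((Set.toFinite {a, b}).isCompact_convexHull ℝ).isClosed
  have hlow : lowerBoundary v L R =
      ⋃ k ∈ Set.Ico 1 (R - L).val, edgeSet v (L + ((k : ℕ) : ZMod n)) := by
    ext q
    simp [lowerBoundary, and_assoc]
  unfold botBoundary
  rw [hlow]
  refine IsClosed.union (IsClosed.union (IsClosed.union ?_ (hseg _ _)) (hseg _ _)) (hseg _ _)
  exact (Set.finite_Ico _ _).isClosed_biUnion fun _ _ => hseg _ _

theorem region_mem_nhds (h : IsLowerChain v L R m) {q : ℝ × ℝ} (hq : q ∈ region v L m)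
    (hJ : q ∉ botBoundary v L R) : region v L m ∈ 𝓝 q := by
  rw [h.mem_botBoundary] at hJ
  push Not at hJ
  obtain ⟨j1, j2, j3, j4, j5⟩ := hJ
  have hle : ∀ s, (chainY v L s : ℝ) ≤ yMax v := fun s => by exact_mod_cast Y_le_yMax s
  have hX : ∀ s < m, (chainX v L s : ℝ) < chainX v L (s + 1) := fun s hs => by
    exact_mod_cast h.X_lt hs
  have hXle : ∀ s t, s ≤ t → t ≤ m → (chainX v L s : ℝ) ≤ chainX v L t := fun s t hs ht => by
    exact_mod_cast h.X_le_of_le hs ht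
  obtain ⟨s, hs, ⟨h1, h2⟩, h3, h4⟩ := mem_region.1 hq
  have h3' : (chainY v L s : ℝ) < q.2 := lt_of_le_of_ne h3 (j1 s hs ⟨h1, h2⟩).symm
  have h4' : q.2 < yMax v := lt_of_le_of_ne h4
    (j4 ⟨(hXle 0 s (by omega) hs.le).trans h1, h2.trans (hXle _ _ hs le_rfl)⟩)
  have key : ∀ s, s + 1 < m → q.1 = chainX v L (s + 1) → (chainY v L s : ℝ) < q.2 →
      (chainY v L (s + 1) : ℝ) < q.2 → region v L m ∈ 𝓝 q := by
    intro s hs e e1 e2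
    have hU : Ioo (chainX v L s : ℝ) (chainX v L (s + 1 + 1)) ×ˢ
        Ioo (max (chainY v L s : ℝ) (chainY v L (s + 1))) (yMax v) ∈ 𝓝 q :=
      (isOpen_Ioo.prod isOpen_Ioo).mem_nhds
        ⟨⟨by rw [e]; exact hX s (by omega), by rw [e]; exact hX _ hs⟩, max_lt e1 e2, h4'⟩
    refine Filter.mem_of_superset hU fun p ⟨⟨p1, p2⟩, p3, p4⟩ => mem_region.2 ?_
    rcases le_total p.1 (chainX v L (s + 1)) with h5 | h5
    · exact ⟨s, by omega, ⟨p1.le, h5⟩, (le_max_left _ _).trans p3.le, p4.le⟩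
    · exact ⟨s + 1, hs, ⟨h5, p2.le⟩, (le_max_right _ _).trans p3.le, p4.le⟩
  rcases h1.eq_or_lt with h5 | h5
  · cases s with
    | zero => exact absurd h4' (not_lt.2 (j3 h5.symm h3).le)
    | succ s =>
      refine key s hs h5.symm ?_ h3'
      by_contra! hc
      exact j2 s hs h5.symm (Set.mem_uIcc.2 (Or.inr ⟨h3, hc⟩))
  rcases h2.eq_or_lt with h6 | h6
  · rcases Nat.lt_or_ge (s + 1) m with h7 | h7
    · refine key s h7 h6 h3' ?_
      by_contra! hc
      exact j2 s h7 h6 (Set.mem_uIcc.2 (Or.inl ⟨h3, hc⟩))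
    · obtain rfl : m = s + 1 := by omega
      exact absurd h4' (not_lt.2 (j5 h6 h3).le)
  · have hU : Ioo (chainX v L s : ℝ) (chainX v L (s + 1)) ×ˢ
        Ioo (chainY v L s : ℝ) (yMax v) ∈ 𝓝 q :=
      (isOpen_Ioo.prod isOpen_Ioo).mem_nhds ⟨⟨h5, h6⟩, h3', h4'⟩
    exact Filter.mem_of_superset hU fun p ⟨⟨p1, p2⟩, p3, p4⟩ =>
      mem_region.2 ⟨s, hs, ⟨p1.le, p2.le⟩, p3.le, p4.le⟩

theorem isOpen_region_diff (h : IsLowerChain v L R m) :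
    IsOpen (region v L m \ botBoundary v L R) := by
  rw [isOpen_iff_mem_nhds]
  exact fun q hq => Filter.inter_mem (h.region_mem_nhds hq.1 hq.2)
    ((isClosed_botBoundary v L R).isOpen_compl.mem_nhds hq.2)

theorem not_isBounded_of_Iic {x y : ℝ} {S : Set (ℝ × ℝ)} (hS : ∀ z ≤ y, (x, z) ∈ S) :
    ¬ Bornology.IsBounded S := by
  intro hb
  obtain ⟨B, hB⟩ := hb.subset_closedBall (x, y)
  have := hB (hS (y - (|B| + 1)) (by have := abs_nonneg B; linarith))
  rw [Metric.mem_closedBall, dist_comm, Prod.dist_eq] at this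
  have h2 := (le_max_right _ _).trans this
  dsimp only at h2
  rw [Real.dist_eq] at h2
  have := (le_abs_self _).trans h2
  have := le_abs_self B
  linarith

theorem not_isBounded_of_Ici {x y : ℝ} {S : Set (ℝ × ℝ)} (hS : ∀ z, y ≤ z → (x, z) ∈ S) :
    ¬ Bornology.IsBounded S := by
  intro hb
  obtain ⟨B, hB⟩ := hb.subset_closedBall (x, y)
  have := hB (hS (y + (|B| + 1)) (by have := abs_nonneg B; linarith))
  rw [Metric.mem_closedBall, Prod.dist_eq] at this
  have h2 := (le_max_right _ _).trans this
  dsimp only at h2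
  rw [Real.dist_eq] at h2
  have := (le_abs_self _).trans h2
  have := le_abs_self B
  linarith

theorem botRegion_eq (h : IsLowerChain v L R m) : botRegion v L R = region v L m := by
  apply Set.Subset.antisymm
  · refine Set.union_subset h.botBoundary_subset fun q hq => ?_
    obtain ⟨hqJ, hb⟩ := hq
    by_contra hqK
    have hline : ∀ I : Set ℝ, IsPreconnected I → q.2 ∈ I → (∀ z ∈ I, (q.1, z) ∉ region v L m) →
        ∀ z ∈ I, (q.1, z) ∈ connectedComponentIn (botBoundary v L R)ᶜ q := by
      intro I hI hqI hz z hzI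
      have h1 : IsPreconnected ((fun z => (q.1, z)) '' I) :=
        hI.image _ (by fun_prop)
      refine h1.subset_connectedComponentIn ⟨q.2, hqI, rfl⟩ ?_ ⟨z, hzI, rfl⟩
      rintro _ ⟨z, hzI, rfl⟩ hzJ
      exact hz z hzI (h.botBoundary_subset hzJ)
    rcases le_or_gt q.2 (yMax v) with h1 | h1
    · refine not_isBounded_of_Iic (x := q.1) (y := q.2)
        (hline (Iic q.2) isPreconnected_Iic (by simp) fun z hz hzK => hqK ?_) hb
      obtain ⟨s, hs, h2, h3, h4⟩ := mem_region.1 hzK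
      exact mem_region.2 ⟨s, hs, h2, h3.trans hz, h1⟩
    · refine not_isBounded_of_Ici (x := q.1) (y := q.2)
        (hline (Ici q.2) isPreconnected_Ici (by simp) fun z hz hzK => ?_) hb
      obtain ⟨s, hs, h2, h3, h4⟩ := mem_region.1 hzK
      exact absurd (h1.trans_le hz) (not_lt.2 h4)
  · intro q hq
    by_cases hqJ : q ∈ botBoundary v L R
    · exact Or.inl hqJ
    · refine Or.inr ⟨hqJ, (isBounded_region (v := v) (L := L) (m := m)).subset ?_⟩
      refine (IsPreconnected.subset_left_of_subset_union h.isOpen_region_diff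
        (isClosed_region (v := v) (L := L) (m := m)).isOpen_compl ?_ ?_ ?_
        isPreconnected_connectedComponentIn).trans Set.sdiff_subset
      · exact Set.disjoint_left.2 fun p h1 h2 => h2 h1.1
      · intro p hp
        by_cases hpK : p ∈ region v L m
        · exact Or.inl ⟨hpK, connectedComponentIn_subset _ _ hp⟩
        · exact Or.inr hpK
      · exact ⟨q, mem_connectedComponentIn hqJ, hq, hqJ⟩

/-! ## The lowest position of a bar -/

/-- `y` is the largest height of a horizontal edge of the lower boundary that passes over the
interior of `[p, p + w]`. -/
def _root_.RectHole.IsWindowMax (v : ZMod n → ℤ × ℤ) (L : ZMod n) (m w : ℕ) (p y : ℤ) : Prop :=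
  (∃ s < m, chainX v L s < p + w ∧ p < chainX v L (s + 1) ∧ chainY v L s = y) ∧
    ∀ s < m, chainX v L s < p + w → p < chainX v L (s + 1) → chainY v L s ≤ y

theorem isLeast_barHeights (h : IsLowerChain v L R m) {w : ℕ} (hw : 0 < w) {p y : ℤ}
    (hp : chainX v L 0 ≤ p) (hp' : p + w ≤ chainX v L m) (hy : IsWindowMax v L m w p y) :
    IsLeast (barHeights v L R w p) (y : ℝ) := by
  have hseg : ∀ z : ℝ, segment ℝ ((p : ℝ), z) ((p : ℝ) + w, z) =
      {q | q.1 ∈ Icc (p : ℝ) (p + w) ∧ q.2 = z} := fun z => by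
    rw [segment_horizontal, Set.uIcc_of_le (by simp)]
  have hpR : (chainX v L 0 : ℝ) ≤ p := by exact_mod_cast hp
  have hpR' : (p : ℝ) + w ≤ chainX v L m := by exact_mod_cast hp'
  have hwR : (0 : ℝ) < w := by exact_mod_cast hw
  constructor
  · change segment ℝ _ _ ⊆ _
    rw [hseg, h.botRegion_eq]
    rintro ⟨x, z⟩ ⟨⟨h1, h2⟩, rfl : z = y⟩
    dsimp only at h1 h2
    have hymax : y ≤ yMax v := by
      obtain ⟨s, -, -, -, rfl⟩ := hy.1
      exact Y_le_yMax s
    obtain ⟨s, hs, h3, h4, h5, h6⟩ : ∃ s < m, (chainX v L s : ℝ) ≤ x ∧ x ≤ chainX v L (s + 1) ∧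
        (chainX v L s : ℝ) < p + w ∧ (p : ℝ) < chainX v L (s + 1) := by
      rcases h2.lt_or_eq with h2 | h2
      · obtain ⟨s, hs, h3, h4⟩ := exists_edge_right (hpR.trans h1) (h2.trans_le hpR')
        exact ⟨s, hs, h3, h4.le, by linarith, by linarith⟩
      · obtain ⟨s, hs, h3, h4⟩ := exists_edge_left (v := v) (L := L) (m := m) (x := x)
          (by linarith) (by linarith)
        exact ⟨s, hs, h3.le, h4, by linarith, by linarith⟩
    refine mem_region.2 ⟨s, hs, ⟨h3, h4⟩, ?_, ?_⟩ <;> dsimp only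
    · exact_mod_cast hy.2 s hs (by exact_mod_cast h5) (by exact_mod_cast h6)
    · exact_mod_cast hymax
  · intro z hz
    change segment ℝ _ _ ⊆ _ at hz
    rw [hseg, h.botRegion_eq] at hz
    obtain ⟨s, hs, h1, h2, rfl⟩ := hy.1
    have hXs := h.X_lt hs
    obtain ⟨c, hc1, hc2, hc3, hc4⟩ : ∃ c : ℤ, p ≤ c ∧ c < p + w ∧ chainX v L s ≤ c ∧
        c < chainX v L (s + 1) := ⟨max p (chainX v L s), by omega, by omega, by omega, by omega⟩
    have hc1' : (p : ℝ) ≤ c := by exact_mod_cast hc1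
    have hc2' : (c : ℝ) + 1 ≤ p + w := by exact_mod_cast hc2
    obtain ⟨t, ht, ⟨h3, h4⟩, h5, -⟩ := mem_region.1 (@hz ((c : ℝ) + 1 / 2, z)
      ⟨⟨by dsimp only; linarith, by dsimp only; linarith⟩, rfl⟩)
    dsimp only at h3 h4 h5
    have h3' : chainX v L t < c + 1 := by
      have : (chainX v L t : ℝ) < c + 1 := by linarith
      exact_mod_cast this
    have h4' : c < chainX v L (t + 1) := by
      have : (c : ℝ) < chainX v L (t + 1) := by linarith
      exact_mod_cast this
    have e1 := h.lt_of_X_lt (s := t) (t := s + 1) ht.le (by omega)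
    have e2 := h.lt_of_X_lt (s := s) (t := t + 1) hs.le (by omega)
    obtain rfl : t = s := by omega
    exact h5

omit [NeZero n] in
theorem exists_isWindowMax {w : ℕ} (hw : 0 < w) {p : ℤ}
    (hp : chainX v L 0 ≤ p) (hp' : p + w ≤ chainX v L m) : ∃ y, IsWindowMax v L m w p y := by
  obtain ⟨s, hs, h1, h2⟩ := exists_edge_right (v := v) (L := L) (m := m) (x := p)
    (by exact_mod_cast hp) (by exact_mod_cast (show p < chainX v L m by omega))
  have hne : ((Finset.range m).filter fun s => chainX v L s < p + w ∧
      p < chainX v L (s + 1)).Nonempty := ⟨s, by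
    have h1' : chainX v L s ≤ p := by exact_mod_cast h1
    have h2' : p < chainX v L (s + 1) := by exact_mod_cast h2
    simp only [Finset.mem_filter, Finset.mem_range]
    omega⟩
  obtain ⟨t, ht, hmax⟩ := Finset.exists_max_image _ (chainY v L) hne
  simp only [Finset.mem_filter, Finset.mem_range] at ht hmax
  exact ⟨_, ⟨t, ht.1, ht.2.1, ht.2.2, rfl⟩, fun s h1 h2 h3 => hmax s ⟨h1, h2, h3⟩⟩

theorem lowestBar_eq (h : IsLowerChain v L R m) {w : ℕ} (hw : 0 < w) {p y : ℤ}
    (hp : chainX v L 0 ≤ p) (hp' : p + w ≤ chainX v L m) (hy : IsWindowMax v L m w p y) :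
    lowestBar v L R w p = y :=
  (h.isLeast_barHeights hw hp hp' hy).csInf_eq

end IsLowerChain

/-! ## Breakpoints as a list of transitions -/

/-- The breakpoints caused by the transition of `F` from `p - 1` to `p`. -/
def transition (F : ℤ → ℤ) (p : ℤ) : List (ℤ × ℤ) :=
  if F p < F (p - 1) then [(p, F (p - 1)), (p, F p)]
  else if F (p - 1) < F p then [(p - 1, F (p - 1)), (p - 1, F p)] else []

/-- The breakpoints of `F` caused by the transitions up to `a + j`. -/
def breakpointsUpTo (F : ℤ → ℤ) (a : ℤ) (j : ℕ) : List (ℤ × ℤ) :=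
  (a, F a) :: (List.range j).flatMap fun i : ℕ => transition F (a + i + 1)

theorem breakpointsUpTo_succ (F : ℤ → ℤ) (a : ℤ) (j : ℕ) :
    breakpointsUpTo F a (j + 1) = breakpointsUpTo F a j ++ transition F (a + j + 1) := by
  simp [breakpointsUpTo, List.range_succ, List.flatMap_append]

theorem breakpointsUpTo_eq_of_const {F : ℤ → ℤ} {a : ℤ} {j k : ℕ} (hjk : j ≤ k) {y : ℤ}
    (h : ∀ p, a + j ≤ p → p ≤ a + k → F p = y) :
    breakpointsUpTo F a k = breakpointsUpTo F a j := by
  induction k, hjk using Nat.le_induction with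
  | base => rfl
  | succ k hjk ih =>
    rw [breakpointsUpTo_succ, ih fun p h1 h2 => h p h1 (by push_cast; omega), transition,
      h (a + k + 1) (by omega) (by push_cast; omega), add_sub_cancel_right,
      h (a + k) (by omega) (by push_cast; omega)]
    simp

theorem breakpoints_eq {f : ℤ → ℝ} {F : ℤ → ℤ} {a b : ℤ} {N : ℕ} (hb : b = a + N)
    (hf : ∀ p, a ≤ p → p ≤ b → f p = F p) :
    breakpoints f a b = (breakpointsUpTo F a N ++ [(b, F b)]).map toPlane := by
  have key : ∀ k : ℕ, k ≤ N →
      (List.range k).flatMap (fun j : ℕ => breakpointsAt f a b (a + j)) ++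
        (if a < a + k ∧ f (a + k) < f (a + k - 1) then
          [(((a + k : ℤ) : ℝ), f (a + k - 1)), (((a + k : ℤ) : ℝ), f (a + k))] else []) =
      ((List.range k).flatMap fun i : ℕ => transition F (a + i + 1)).map toPlane := by
    intro k
    induction k with
    | zero => simp
    | succ k ih =>
      intro hk
      rw [List.range_succ, List.flatMap_append, List.flatMap_append, List.map_append,
        ← ih (by omega)]
      simp only [List.flatMap_singleton, List.append_assoc]
      congr 1
      have e : a + ((k + 1 : ℕ) : ℤ) = a + k + 1 := by push_cast; ring
      rw [breakpointsAt, List.append_assoc, e, add_sub_cancel_right, transition,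
        add_sub_cancel_right]
      congr 1
      rw [hf (a + k) (by omega) (by omega), hf (a + k + 1) (by omega) (by omega)]
      simp only [Int.cast_lt]
      rcases lt_trichotomy (F (a + k)) (F (a + k + 1)) with h | h | h
      · rw [if_pos ⟨by omega, h⟩, if_neg (by omega), if_neg (by omega), if_pos h]
        simp [toPlane]
      · rw [if_neg (by omega), if_neg (by omega), if_neg (by omega), if_neg (by omega)]
        simp
      · rw [if_neg (by omega), if_pos (by omega), if_pos h]
        simp [toPlane]
  have hN := key N le_rfl
  have e : (b - a + 1).toNat = N + 1 := by omega
  have e' : (do let k ← List.range (N + 1); pure (k : ℤ)) =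
      (List.range (N + 1)).map fun k : ℕ => (k : ℤ) := by
    simp [List.map_eq_flatMap]
  unfold breakpoints breakpointsUpTo
  rw [e, e', List.flatMap_map, List.range_succ, List.flatMap_append, List.cons_append, List.cons_append, List.map_cons,
    List.map_append, ← hN]
  simp only [List.flatMap_singleton, List.append_assoc, List.map_cons, List.map_nil]
  rw [breakpointsAt, if_neg (by omega : ¬ (a + (N : ℤ) < b ∧ _)), List.append_nil,
    hf a le_rfl (by omega), hf b (by omega) le_rfl]
  rfl

/-! ## Suffix maxima -/

/-- Insertion of `a` at the front of a deque, if it is strictly higher than the front. -/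
def pushFront (Y : ℕ → ℤ) (a : ℕ) : List ℕ → List ℕ
  | [] => [a]
  | e :: es => if Y e < Y a then a :: e :: es else e :: es

/-- The indices `q` in `[a, a + l)` with `Y q` larger than all later values, in increasing
order. -/
def suffixMaxima (Y : ℕ → ℤ) : ℕ → ℕ → List ℕ
  | _, 0 => []
  | a, l + 1 => pushFront Y a (suffixMaxima Y (a + 1) l)

theorem pushFront_cons (Y : ℕ → ℤ) (a e : ℕ) (es : List ℕ) :
    pushFront Y a (e :: es) = if Y e < Y a then a :: e :: es else e :: es := rfl

theorem suffixMaxima_eq_nil_iff {Y : ℕ → ℤ} {a l : ℕ} : suffixMaxima Y a l = [] ↔ l = 0 := by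
  cases l with
  | zero => simp [suffixMaxima]
  | succ l =>
    unfold suffixMaxima pushFront
    split
    · simp
    · split_ifs <;> simp

theorem length_suffixMaxima_le (Y : ℕ → ℤ) (a l : ℕ) : (suffixMaxima Y a l).length ≤ l := by
  induction l generalizing a with
  | zero => simp [suffixMaxima]
  | succ l ih =>
    have := ih (a + 1)
    unfold suffixMaxima pushFront
    split
    · simp
    · rename_i h
      rw [h] at this
      split_ifs <;> simp at this ⊢ <;> omega

theorem suffixMaxima_cons {Y : ℕ → ℤ} {a l q : ℕ} {t : List ℕ} (h : suffixMaxima Y a l = q :: t) :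
    (∀ x, a ≤ x → x < a + l → Y x ≤ Y q) ∧ a ≤ q ∧ q < a + l ∧
      t = suffixMaxima Y (q + 1) (a + l - (q + 1)) := by
  induction l generalizing a q t with
  | zero => simp [suffixMaxima] at h
  | succ l ih =>
    unfold suffixMaxima at h
    rcases hs : suffixMaxima Y (a + 1) l with _ | ⟨e, es⟩
    · rw [hs] at h
      obtain rfl : l = 0 := suffixMaxima_eq_nil_iff.1 hs
      simp only [pushFront, List.cons.injEq] at h
      obtain ⟨rfl, rfl⟩ := h
      refine ⟨fun x h1 h2 => ?_, le_rfl, by omega, by simp [suffixMaxima]⟩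
      obtain rfl : x = a := by omega
      exact le_rfl
    · obtain ⟨i1, i2, i3, i4⟩ := ih hs
      rw [hs] at h
      rw [pushFront_cons] at h
      split_ifs at h with hlt
      · obtain ⟨rfl, rfl⟩ := List.cons.inj h
        refine ⟨fun x h1 h2 => ?_, le_rfl, by omega, ?_⟩
        · rcases h1.eq_or_lt with rfl | h1
          · exact le_rfl
          · exact (i1 x h1 (by omega)).trans hlt.le
        · rw [← hs]
          congr 1
          omega
      · obtain ⟨rfl, rfl⟩ := List.cons.inj h
        refine ⟨fun x h1 h2 => ?_, by omega, by omega, ?_⟩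
        · rcases h1.eq_or_lt with rfl | h1
          · exact not_lt.1 hlt
          · exact i1 x h1 (by omega)
        · rw [i4]
          congr 1
          omega

theorem pairwise_suffixMaxima (Y : ℕ → ℤ) (a l : ℕ) :
    (suffixMaxima Y a l).Pairwise fun p q => Y q < Y p := by
  induction l generalizing a with
  | zero => simp [suffixMaxima]
  | succ l ih =>
    have h := ih (a + 1)
    rw [suffixMaxima]
    generalize suffixMaxima Y (a + 1) l = rs at h
    rcases rs with _ | ⟨e, es⟩
    · simp [pushFront]
    · rw [pushFront_cons]
      split_ifs with hlt
      · refine List.pairwise_cons.2 ⟨fun q hq => ?_, h⟩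
        rcases List.mem_cons.1 hq with rfl | hq
        · exact hlt
        · exact ((List.pairwise_cons.1 h).1 q hq).trans hlt
      · exact h

/-- `q` is higher than the front of the deque `l`. -/
def exceedsFront (Y : ℕ → ℤ) (l : List ℕ) (q : ℕ) : Bool :=
  match l with
  | [] => true
  | e :: _ => decide (Y e < Y q)

theorem suffixMaxima_add (Y : ℕ → ℤ) (a l l' : ℕ) :
    suffixMaxima Y a (l + l') =
      (suffixMaxima Y a l).filter (exceedsFront Y (suffixMaxima Y (a + l) l')) ++
        suffixMaxima Y (a + l) l' := by
  induction l generalizing a with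
  | zero => simp [suffixMaxima]
  | succ l ih =>
    have hp := pairwise_suffixMaxima Y (a + 1) l
    rw [show l + 1 + l' = l + l' + 1 by omega]
    rw [suffixMaxima, ih (a + 1), suffixMaxima, show a + 1 + l = a + (l + 1) by omega]
    generalize suffixMaxima Y (a + 1) l = rs at hp
    rcases suffixMaxima Y (a + (l + 1)) l' with _ | ⟨h, t⟩
    · have hT : exceedsFront Y [] = fun _ => true := rfl
      simp [hT]
    rcases rs with _ | ⟨e, es⟩
    · by_cases hlt : Y h < Y a <;> simp [exceedsFront, pushFront, hlt]
    have hes := (List.pairwise_cons.1 hp).1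
    by_cases he : Y h < Y e
    · by_cases hlt : Y e < Y a
      · simp [exceedsFront, pushFront, he, hlt, he.trans hlt]
      · simp [exceedsFront, pushFront, he, hlt]
    · have hnil : es.filter (exceedsFront Y (h :: t)) = [] := by
        rw [List.filter_eq_nil_iff]
        intro q hq
        have := hes q hq
        simp only [exceedsFront, decide_eq_true_eq]
        omega
      have hnil' : (e :: es).filter (exceedsFront Y (h :: t)) = [] := by
        rw [List.filter_cons, hnil]
        simp [exceedsFront, he]
      rw [hnil', List.nil_append]
      rw [pushFront_cons, pushFront_cons]
      split_ifs with h1 h2 h2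
      · rw [List.filter_cons, hnil']
        simp [exceedsFront, h1]
      · rw [hnil']
        omega
      · rw [List.filter_cons, hnil']
        simp [exceedsFront, h1]
      · rw [hnil']
        rfl

/-! ## The loops of the algorithm -/

/-- The `k`-th vertical edge after `L`. -/
def verticalIdx {n : ℕ} (L : ZMod n) (k : ℕ) : ZMod n := L + ((2 * k : ℕ) : ZMod n)

/-- The `k`-th horizontal edge after `L`. -/
def horizontalIdx {n : ℕ} (L : ZMod n) (k : ℕ) : ZMod n := L + ((2 * k + 1 : ℕ) : ZMod n)

theorem verticalIdx_succ {n : ℕ} (L : ZMod n) (k : ℕ) :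
    verticalIdx L (k + 1) = verticalIdx L k + 2 := by
  unfold verticalIdx; push_cast; ring

theorem horizontalIdx_succ_sub {n : ℕ} (L : ZMod n) (k : ℕ) :
    horizontalIdx L (k + 1) - 2 = horizontalIdx L k := by
  unfold horizontalIdx; push_cast; ring

theorem verticalIdx_succ_sub {n : ℕ} (L : ZMod n) (k : ℕ) :
    verticalIdx L (k + 1) - 1 = horizontalIdx L k := by
  unfold horizontalIdx verticalIdx; push_cast; ring

theorem natCast_add_inj {n : ℕ} {L : ZMod n} {a b : ℕ} (ha : a < n) (hb : b < n) :
    L + (a : ZMod n) = L + (b : ZMod n) ↔ a = b := by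
  rw [add_right_inj, ZMod.natCast_eq_natCast_iff']
  rw [Nat.mod_eq_of_lt ha, Nat.mod_eq_of_lt hb]

namespace IsLowerChain

variable {n : ℕ} [NeZero n] {v : ZMod n → ℤ × ℤ} {L R : ZMod n} {m w : ℕ}

theorem horizontalIdx_inj (h : IsLowerChain v L R m) {a b : ℕ} (ha : a < m) (hb : b < m) :
    horizontalIdx L a = horizontalIdx L b ↔ a = b := by
  have := h.two_mul_lt
  unfold horizontalIdx
  rw [natCast_add_inj (by omega) (by omega)]
  omega

theorem verticalIdx_eq_R_iff (h : IsLowerChain v L R m) {a : ℕ} (ha : a ≤ m) :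
    verticalIdx L a = R ↔ a = m := by
  have := h.two_mul_lt
  rw [h.eq_R, verticalIdx, natCast_add_inj (by omega) (by omega)]
  omega

omit [NeZero n] in
theorem upper_eq (h : IsLowerChain v L R m) {k : ℕ} (hk : k < m) :
    upper v (verticalIdx L (k + 1)) =
      (chainX v L (k + 1), max (chainY v L k) (chainY v L (k + 1))) := by
  unfold upper verticalIdx
  rw [even_succ, h.eq_right hk, eq_left v L]
  dsimp only
  split_ifs with hc
  · rw [max_eq_left hc]
  · rw [max_eq_right (by omega)]

omit [NeZero n] in
theorem lower_eq (h : IsLowerChain v L R m) {k : ℕ} (hk : k < m) :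
    lower v (verticalIdx L (k + 1)) =
      (chainX v L (k + 1), min (chainY v L k) (chainY v L (k + 1))) := by
  unfold lower verticalIdx
  rw [even_succ, h.eq_right hk, eq_left v L]
  dsimp only
  split_ifs with hc
  · rw [min_eq_right hc]
  · rw [min_eq_left (by omega)]

omit [NeZero n] in
theorem onLine_eq (h : IsLowerChain v L R m) {k : ℕ} (hk : k < m) {b : ℤ × ℤ}
    (hb : b.2 = chainY v L k) :
    onLine v (verticalIdx L (k + 1)) b = (chainX v L (k + 1), chainY v L k) := by
  unfold onLine
  rw [h.upper_eq hk, h.lower_eq hk, hb]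
  dsimp only
  split_ifs with hc
  · rw [hc]
  · congr 1
    omega

omit [NeZero n] in
theorem rightVertex_eq (h : IsLowerChain v L R m) {k : ℕ} (hk : k < m) :
    rightVertex v (horizontalIdx L k) = (chainX v L (k + 1), chainY v L k) := by
  unfold rightVertex horizontalIdx
  have := h.X_lt hk
  rw [odd_succ, h.eq_right hk, eq_left v L, if_neg (by simpa using this)]

omit [NeZero n] in
theorem vertical_X (h : IsLowerChain v L R m) {k : ℕ} (hk : k < m) :
    (v (verticalIdx L (k + 1))).1 = chainX v L (k + 1) := by
  unfold verticalIdx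
  rw [h.eq_right hk]

theorem setup_loop (h : IsLowerChain v L R m) {s : State n} {σ d l : ℕ} (hloc : s.loc = Loc.setup)
    (hstart : s.start = verticalIdx L (σ + 1)) (hk : s.k = horizontalIdx L (σ + d))
    (hQ : s.Q' = (suffixMaxima (chainY v L) (σ + 1 + d) l).map (horizontalIdx L))
    (hd : σ + d < m) :
    (step v L R w)^[d + 1] s = { s with
      loc := .merge, k := horizontalIdx L σ,
      Q' := (suffixMaxima (chainY v L) (σ + 1) (d + l)).map (horizontalIdx L) } := by
  induction d generalizing s l with
  | zero =>
    obtain ⟨loc, b₁, b₂, out, Q, Q', support, start, r, k⟩ := s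
    dsimp only at hloc hstart hk hQ
    subst hloc hstart hk hQ
    simp [step, verticalIdx_succ_sub]
  | succ d ih =>
    obtain ⟨loc, b₁, b₂, out, Q, Q', support, start, r, k⟩ := s
    dsimp only at hloc hstart hk hQ
    subst hloc hstart hk hQ
    have hne : horizontalIdx L (σ + (d + 1)) ≠ horizontalIdx L σ := by
      rw [Ne, h.horizontalIdx_inj hd (by omega)]
      omega
    have hY : ∀ k, (v (horizontalIdx L k)).2 = chainY v L k := fun _ => rfl
    have hsub : horizontalIdx L (σ + (d + 1)) - 2 = horizontalIdx L (σ + d) :=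
      horizontalIdx_succ_sub L (σ + d)
    rw [Function.iterate_succ_apply, ih (l := l + 1)]
    · simp only [step, verticalIdx_succ_sub, if_neg hne]
      rw [show d + (l + 1) = d + 1 + l by omega]
      split
      · rfl
      · split_ifs <;> rfl
    · simp only [step, verticalIdx_succ_sub, if_neg hne]
      split
      · rfl
      · split_ifs <;> rfl
    · simp only [step, verticalIdx_succ_sub, if_neg hne]
      split
      · rfl
      · split_ifs <;> rfl
    · simp only [step, verticalIdx_succ_sub, if_neg hne, hsub]
      split
      · rfl
      · split_ifs <;> rfl
    · simp only [step, verticalIdx_succ_sub, if_neg hne]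
      rw [show σ + 1 + d = σ + (d + 1) by omega, suffixMaxima,
        show σ + (d + 1) + 1 = σ + 1 + (d + 1) by omega]
      rcases suffixMaxima (chainY v L) (σ + 1 + (d + 1)) l with _ | ⟨e, es⟩
      · rfl
      · simp only [List.map_cons, hY, pushFront_cons]
        split_ifs <;> rfl
    · omega

omit [NeZero n] in
theorem merge_loop {s : State n} {q q' : List ℕ} (hloc : s.loc = Loc.merge)
    (hQ : s.Q = q.map (horizontalIdx L)) (hQ' : s.Q' = q'.map (horizontalIdx L))
    (hq : q.Pairwise fun a b => chainY v L b < chainY v L a) :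
    ∃ t, t + (q.filter (exceedsFront (chainY v L) q')).length ≤ q.length + 1 ∧
      (step v L R w)^[t] s = { s with
        loc := .append
        Q := (q.filter (exceedsFront (chainY v L) q')).map (horizontalIdx L) } := by
  have hY : ∀ k, (v (horizontalIdx L k)).2 = chainY v L k := fun _ => rfl
  induction q using List.reverseRecOn generalizing s with
  | nil =>
    obtain ⟨loc, b₁, b₂, out, Q, Q', support, start, r, k⟩ := s
    dsimp only at hloc hQ hQ'
    subst hloc hQ hQ'
    exact ⟨1, by simp, by simp [step]⟩
  | append_singleton q x ih =>
    obtain ⟨loc, b₁, b₂, out, Q, Q', support, start, r, k⟩ := s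
    dsimp only at hloc hQ hQ'
    subst hloc hQ hQ'
    rcases q' with _ | ⟨e, es⟩
    · have hT : exceedsFront (chainY v L) [] = fun _ => true := rfl
      refine ⟨1, by simp [hT]; omega, by simp [hT, step]⟩
    · obtain ⟨hq1, -, hq2⟩ := List.pairwise_append.1 hq
      by_cases hx : chainY v L x ≤ chainY v L e
      · have hf : (q ++ [x]).filter (exceedsFront (chainY v L) (e :: es)) =
            q.filter (exceedsFront (chainY v L) (e :: es)) := by
          simp [List.filter_append, exceedsFront, hx]
        obtain ⟨t, ht, ht'⟩ := ih (s := ⟨.merge, b₁, b₂, out, q.map (horizontalIdx L),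
          (e :: es).map (horizontalIdx L), support, start, r, k⟩) rfl rfl rfl hq1
        refine ⟨t + 1, ?_, ?_⟩
        · rw [hf]
          simp only [List.length_append, List.length_singleton]
          omega
        · rw [Function.iterate_succ_apply, hf]
          convert ht' using 2
          simp [step, hY, hx]
      · have hf : (q ++ [x]).filter (exceedsFront (chainY v L) (e :: es)) = q ++ [x] := by
          rw [List.filter_eq_self]
          intro a ha
          simp only [exceedsFront, decide_eq_true_eq]
          rcases List.mem_append.1 ha with ha | ha
          · have := hq2 a ha x (by simp)
            omega
          · rw [List.mem_singleton.1 ha]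
            omega
        refine ⟨1, by rw [hf]; omega, ?_⟩
        rw [hf]
        simp [step, hY, hx]

omit [NeZero n] in
theorem append_loop {s : State n} (hloc : s.loc = Loc.append) :
    (step v L R w)^[s.Q'.length + 1] s = { s with
      loc := .lowerBar, Q := s.Q ++ s.Q', Q' := [] } := by
  obtain ⟨loc, b₁, b₂, out, Q, Q', support, start, r, k⟩ := s
  dsimp only at hloc
  subst hloc
  dsimp only
  induction Q' generalizing Q with
  | nil => simp [step]
  | cons e es ih =>
    rw [List.length_cons, Function.iterate_succ_apply]
    have : step v L R w ⟨.append, b₁, b₂, out, Q, e :: es, support, start, r, k⟩ =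
      ⟨.append, b₁, b₂, out, Q ++ [e], es, support, start, r, k⟩ := rfl
    rw [this, ih]
    simp

/-- From the end of the inner loop the deque `Q` is updated in time linear in the number of edges
inserted and removed. -/
theorem drop_phase (h : IsLowerChain v L R m) {s : State n} {i σ ρ : ℕ} (hloc : s.loc = Loc.drop)
    (hstart : s.start = verticalIdx L σ) (hr : s.r = verticalIdx L ρ) (hi : i < σ) (hσ : σ ≤ ρ)
    (hρ : ρ ≤ m)
    (hQ : s.Q = (suffixMaxima (chainY v L) (i + 1) (σ - (i + 1))).map (horizontalIdx L)) :
    ∃ t k, t + (suffixMaxima (chainY v L) (i + 1) (ρ - (i + 1))).length ≤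
        s.Q.length + 3 * (ρ - σ) + 4 ∧
      (step v L R w)^[t] s = { s with
        loc := .lowerBar, b₁ := s.support, b₂ := (s.support.1 + w, s.support.2)
        Q := (suffixMaxima (chainY v L) (i + 1) (ρ - (i + 1))).map (horizontalIdx L)
        Q' := [], k := k } := by
  obtain ⟨loc, b₁, b₂, out, Q, Q', support, start, r, k⟩ := s
  dsimp only at hloc hstart hr hQ
  subst hloc hstart hr hQ
  obtain ⟨σ, rfl⟩ : ∃ a, σ = a + 1 := ⟨σ - 1, by omega⟩
  obtain ⟨d, rfl⟩ := Nat.exists_eq_add_of_le hσ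
  have e1 := h.setup_loop (w := w) (l := 0) (σ := σ) (d := d)
    (s := step v L R w ⟨.drop, b₁, b₂, out,
      (suffixMaxima (chainY v L) (i + 1) (σ + 1 - (i + 1))).map (horizontalIdx L), Q', support,
      verticalIdx L (σ + 1), verticalIdx L (σ + 1 + d), k⟩) rfl rfl
    (by
      change verticalIdx L (σ + 1 + d) - 1 = _
      rw [show σ + 1 + d = σ + d + 1 by omega, verticalIdx_succ_sub]) rfl (by omega)
  rw [← Function.iterate_succ_apply] at e1
  simp only [step] at e1
  set q := suffixMaxima (chainY v L) (i + 1) (σ + 1 - (i + 1)) with hq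
  set q' := suffixMaxima (chainY v L) (σ + 1) (d + 0) with hq'
  have hadd := suffixMaxima_add (chainY v L) (i + 1) (σ + 1 - (i + 1)) d
  rw [show i + 1 + (σ + 1 - (i + 1)) = σ + 1 by omega,
    show σ + 1 - (i + 1) + d = σ + 1 + d - (i + 1) by omega, ← hq,
    show suffixMaxima (chainY v L) (σ + 1) d = q' from rfl] at hadd
  have hlen : q'.length ≤ d := length_suffixMaxima_le _ _ _
  obtain ⟨t, ht, e2⟩ := merge_loop (R := R) (w := w) (L := L) (v := v) (q := q) (q' := q')
    (s := ⟨.merge, support, (support.1 + w, support.2), out, q.map (horizontalIdx L),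
      q'.map (horizontalIdx L), support, verticalIdx L (σ + 1), verticalIdx L (σ + 1 + d),
      horizontalIdx L σ⟩) rfl rfl rfl (pairwise_suffixMaxima _ _ _)
  have e3 := append_loop (v := v) (L := L) (R := R) (w := w) (s := ⟨.append, support,
      (support.1 + w, support.2), out,
      (q.filter (exceedsFront (chainY v L) q')).map (horizontalIdx L),
      q'.map (horizontalIdx L), support, verticalIdx L (σ + 1), verticalIdx L (σ + 1 + d),
      horizontalIdx L σ⟩) rfl
  refine ⟨(q'.map (horizontalIdx L)).length + 1 + (t + (d + 1).succ), horizontalIdx L σ, ?_, ?_⟩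
  · rw [hadd]
    simp only [List.length_append, List.length_map]
    omega
  · dsimp only at e3
    rw [Function.iterate_add_apply _ ((q'.map (horizontalIdx L)).length + 1),
      Function.iterate_add_apply _ t, e1, e2, e3, hadd, List.map_append]

end IsLowerChain

/-! ## Correctness of the algorithm -/

theorem IsWindowMax.unique {n : ℕ} {v : ZMod n → ℤ × ℤ} {L : ZMod n} {m w : ℕ} {p y z : ℤ}
    (hy : IsWindowMax v L m w p y) (hz : IsWindowMax v L m w p z) : y = z := by
  obtain ⟨⟨s, s1, s2, s3, rfl⟩, hs⟩ := hy
  obtain ⟨⟨t, t1, t2, t3, rfl⟩, ht⟩ := hz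
  exact le_antisymm (ht s s1 s2 s3) (hs t t1 t2 t3)

/-- The state at the test of the inner loop. The bar has been moved to the abscissa
`chainX v L 0 + j`, it rests on the horizontal edge `i`, and the edges before the vertical edge `ρ`
have been seen; of those beyond `i`, the ones before the vertical edge `σ` are accounted for in
`Q`. -/
structure ScanInv {n : ℕ} (v : ZMod n → ℤ × ℤ) (L : ZMod n) (m w : ℕ) (F : ℤ → ℤ) (s : State n)
    (i σ ρ j : ℕ) : Prop where
  loc : s.loc = Loc.scan
  support : s.support = (chainX v L (i + 1), chainY v L i)
  start : s.start = verticalIdx L σ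
  r : s.r = verticalIdx L ρ
  lt : i < σ
  le : σ ≤ ρ
  le_m : ρ ≤ m
  left : chainX v L i < chainX v L 0 + j + w
  right : chainX v L 0 + j < chainX v L (i + 1)
  seen : chainX v L 0 + j + w ≤ chainX v L ρ
  scanned : chainX v L (ρ - 1) < chainX v L (i + 1) + w
  max : ∀ k < ρ, chainX v L 0 + j < chainX v L (k + 1) → chainY v L k ≤ chainY v L i
  Q : s.Q = (suffixMaxima (chainY v L) (i + 1) (σ - (i + 1))).map (horizontalIdx L)
  out : s.out = breakpointsUpTo F (chainX v L 0) j
  last : (s.out.getLastD (0, 0)).2 = chainY v L i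

/-- An upper bound for the number of steps still to be made. -/
def potential {n : ℕ} (m : ℕ) (s : State n) (i σ ρ : ℕ) : ℕ :=
  (m - ρ) + 7 * (m - i) + 4 * (m - σ) + s.Q.length + 1

namespace ScanInv

variable {n : ℕ} [NeZero n] {v : ZMod n → ℤ × ℤ} {L R : ZMod n} {m w : ℕ} {F : ℤ → ℤ}
  {s : State n} {i σ ρ j : ℕ}

omit [NeZero n] in
theorem eq_of_le (I : ScanInv v L m w F s i σ ρ j) (h : IsLowerChain v L R m)
    (hF : ∀ p, chainX v L 0 ≤ p → p + w ≤ chainX v L m → IsWindowMax v L m w p (F p)) {p : ℤ}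
    (h1 : chainX v L 0 + j ≤ p) (h2 : p < chainX v L (i + 1)) (h3 : p + w ≤ chainX v L ρ) :
    F p = chainY v L i := by
  have hρm := h.X_le_of_le I.le_m le_rfl
  have hlt := I.lt
  have hle := I.le
  have hm := I.le_m
  have hl := I.left
  refine (hF p (by omega) (by omega)).unique
    ⟨⟨i, by omega, by omega, h2, rfl⟩, fun k hk hk1 hk2 => I.max k ?_ (by omega)⟩
  exact h.lt_of_X_lt hk.le (by omega)

theorem finish (I : ScanInv v L m w F s i σ ρ j) (h : IsLowerChain v L R m)
    (hF : ∀ p, chainX v L 0 ≤ p → p + w ≤ chainX v L m → IsWindowMax v L m w p (F p))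
    (hc : chainX v L ρ < chainX v L (i + 1) + w) (hρ : ρ = m) :
    (step v L R w s).loc = Loc.done ∧ (step v L R w s).out =
      breakpointsUpTo F (chainX v L 0) (chainX v L m - w - chainX v L 0).toNat ++
        [(chainX v L m - w, F (chainX v L m - w))] := by
  subst hρ
  have hm := h.one_le
  obtain ⟨k, rfl⟩ : ∃ k, ρ = k + 1 := ⟨ρ - 1, by omega⟩
  have hseen := I.seen
  have hconst := fun p h1 h2 h3 => I.eq_of_le h hF (p := p) h1 h2 h3
  have hR := (h.verticalIdx_eq_R_iff le_rfl).2 rfl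
  have hstep : step v L R w s = { s with
      loc := .done, out := s.out ++ [((v R).1 - w, (s.out.getLastD (0, 0)).2)] } := by
    rw [step, I.loc, I.r, I.support, h.vertical_X (by omega), if_pos hc, if_pos hR]
  rw [hstep]
  refine ⟨rfl, ?_⟩
  dsimp only
  rw [I.last, I.out, h.X_R, hconst _ (by omega) (by omega) (by omega)]
  rw [breakpointsUpTo_eq_of_const (j := j) (k := (chainX v L (k + 1) - w - chainX v L 0).toNat)
    (y := chainY v L i) (by omega)]
  intro p h1 h2
  exact hconst p h1 (by omega) (by omega)

theorem advance (I : ScanInv v L m w F s i σ ρ j) (h : IsLowerChain v L R m)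
    (hc : chainX v L ρ < chainX v L (i + 1) + w) (hρ : ρ ≠ m) (hY : chainY v L ρ ≤ chainY v L i) :
    ScanInv v L m w F (step v L R w s) i σ (ρ + 1) j ∧
      potential m (step v L R w s) i σ (ρ + 1) + 1 ≤ potential m s i σ ρ := by
  have hm := I.le_m
  have hlt := I.lt
  have hle := I.le
  have hseen := I.seen
  obtain ⟨k, rfl⟩ : ∃ k, ρ = k + 1 := ⟨ρ - 1, by omega⟩
  have hR : verticalIdx L (k + 1) ≠ R := fun e => hρ ((h.verticalIdx_eq_R_iff I.le_m).1 e)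
  have hX := h.X_lt (s := k + 1) (by omega)
  have hYk := I.max k (by omega) (by
    have := h.X_le_of_le (s := i + 1) (t := k + 1) (by omega) (by omega)
    have := I.right
    omega)
  have hstep : step v L R w s = { s with r := s.r + 2 } := by
    rw [step, I.loc, I.r, I.support, h.vertical_X (by omega), if_pos hc, if_neg hR,
      h.upper_eq (by omega), if_neg (by dsimp only; omega)]
  rw [hstep]
  refine ⟨⟨I.loc, I.support, I.start, ?_, hlt, by omega, by omega, I.left, I.right, by omega,
    hc, fun t ht ht' => ?_, I.Q, I.out, I.last⟩, ?_⟩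
  · change s.r + 2 = _
    rw [I.r, ← verticalIdx_succ]
  · rcases Nat.lt_succ_iff_lt_or_eq.1 ht with ht | rfl
    · exact I.max t ht ht'
    · exact hY
  · unfold potential
    dsimp only
    omega

theorem rise (I : ScanInv v L m w F s i σ ρ j) (h : IsLowerChain v L R m) (hw : 0 < w)
    (hF : ∀ p, chainX v L 0 ≤ p → p + w ≤ chainX v L m → IsWindowMax v L m w p (F p))
    (hc : chainX v L ρ < chainX v L (i + 1) + w) (hρ : ρ ≠ m) (hY : chainY v L i < chainY v L ρ) :
    ∃ j', ScanInv v L m w F (step v L R w s) ρ (ρ + 1) (ρ + 1) j' ∧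
      potential m (step v L R w s) ρ (ρ + 1) (ρ + 1) + 1 ≤ potential m s i σ ρ := by
  have hm := I.le_m
  have hlt := I.lt
  have hle := I.le
  have hseen := I.seen
  have hright := I.right
  have hconst := fun p h1 h2 h3 => I.eq_of_le h hF (p := p) h1 h2 h3
  have hmax := I.max
  have hlast := I.last
  obtain ⟨k, rfl⟩ : ∃ k, ρ = k + 1 := ⟨ρ - 1, by omega⟩
  have hR : verticalIdx L (k + 1) ≠ R := fun e => hρ ((h.verticalIdx_eq_R_iff I.le_m).1 e)
  have hX := h.X_lt (s := k + 1) (by omega)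
  have hXm := h.X_le_of_le (s := k + 1 + 1) (t := m) (by omega) le_rfl
  have hYk := hmax k (by omega) (by
    have := h.X_le_of_le (s := i + 1) (t := k + 1) (by omega) (by omega); omega)
  have hupper : upper v (verticalIdx L (k + 1)) = (chainX v L (k + 1), chainY v L (k + 1)) := by
    rw [h.upper_eq (by omega), max_eq_right (by omega)]
  have hstep : step v L R w s = { s with
      b₁ := (chainX v L (k + 1) - w, chainY v L (k + 1))
      b₂ := (chainX v L (k + 1), chainY v L (k + 1))
      out := s.out ++ [(chainX v L (k + 1) - w, chainY v L i),
        (chainX v L (k + 1) - w, chainY v L (k + 1))]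
      Q := []
      support := (chainX v L (k + 1 + 1), chainY v L (k + 1))
      start := verticalIdx L (k + 1 + 1)
      r := verticalIdx L (k + 1 + 1) } := by
    have e := h.onLine_eq (k := k + 1) (by omega)
      (b := (chainX v L (k + 1) - w, chainY v L (k + 1))) rfl
    rw [step, I.loc, I.r, I.support, h.vertical_X (by omega), if_pos hc, if_neg hR, hupper,
      if_pos hY]
    dsimp only
    rw [hlast, ← verticalIdx_succ, e]
  rw [hstep]
  obtain ⟨j₀, hj₀⟩ : ∃ j₀ : ℕ, chainX v L (k + 1) - w = chainX v L 0 + j₀ :=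
    ⟨(chainX v L (k + 1) - w - chainX v L 0).toNat, by omega⟩
  have hmax' : ∀ t < k + 1 + 1, chainX v L 0 + ((j₀ + 1 : ℕ) : ℤ) < chainX v L (t + 1) →
      chainY v L t ≤ chainY v L (k + 1) := by
    intro t ht ht'
    rcases Nat.lt_succ_iff_lt_or_eq.1 ht with ht | rfl
    · exact (hmax t ht (by push_cast at ht'; omega)).trans hY.le
    · exact le_rfl
  refine ⟨j₀ + 1, ⟨I.loc, rfl, rfl, rfl, by omega, le_rfl, by omega, by push_cast; omega,
    by push_cast; omega, by push_cast; omega, ?_, hmax', ?_, ?_, ?_⟩, ?_⟩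
  · rw [Nat.add_sub_cancel]; omega
  · simp [suffixMaxima]
  · dsimp only
    have e1 : F (chainX v L 0 + j₀) = chainY v L i := hconst _ (by omega) (by omega) (by omega)
    have e2 : F (chainX v L 0 + j₀ + 1) = chainY v L (k + 1) := by
      refine (hF _ (by omega) (by omega)).unique
        ⟨⟨k + 1, by omega, by omega, by omega, rfl⟩, fun t ht h1 h2 => hmax' t ?_ ?_⟩
      · exact h.lt_of_X_lt ht.le (by omega)
      · push_cast; omega
    rw [breakpointsUpTo_succ, breakpointsUpTo_eq_of_const (j := j) (k := j₀) (y := chainY v L i)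
      (by omega) (fun p h1 h2 => hconst p h1 (by omega) (by omega)), I.out, transition,
      add_sub_cancel_right, e1, e2, if_neg (by omega), if_pos hY, hj₀]
  · simp
  · unfold potential
    simp only [List.length_nil]
    omega

theorem fall (I : ScanInv v L m w F s i σ ρ j) (h : IsLowerChain v L R m) (hw : 0 < w)
    (hF : ∀ p, chainX v L 0 ≤ p → p + w ≤ chainX v L m → IsWindowMax v L m w p (F p))
    (hc : chainX v L (i + 1) + w ≤ chainX v L ρ) :
    ∃ t s' q j', 0 < t ∧ (step v L R w)^[t] s = s' ∧ ScanInv v L m w F s' q ρ ρ j' ∧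
      potential m s' q ρ ρ + t ≤ potential m s i σ ρ := by
  have hm := I.le_m
  have hlt := I.lt
  have hle := I.le
  have hseen := I.seen
  have hright := I.right
  have hscanned := I.scanned
  have hconst := fun p h1 h2 h3 => I.eq_of_le h hF (p := p) h1 h2 h3
  have hmax := I.max
  have hlast := I.last
  have hQ := I.Q
  have hiρ : i + 1 < ρ := h.lt_of_X_lt (by omega) (by omega)
  have hXm := h.X_le_of_le I.le_m le_rfl
  have hstep : step v L R w s = { s with loc := .drop } := by
    obtain ⟨k, rfl⟩ : ∃ k, ρ = k + 1 := ⟨ρ - 1, by omega⟩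
    rw [step, I.loc, I.r, I.support, h.vertical_X (by omega), if_neg (by dsimp only; omega)]
  obtain ⟨t, k, ht, hrun⟩ := h.drop_phase (w := w) (s := { s with loc := .drop }) (i := i) (σ := σ)
    (ρ := ρ) rfl I.start I.r I.lt I.le I.le_m I.Q
  rcases hsm : suffixMaxima (chainY v L) (i + 1) (ρ - (i + 1)) with _ | ⟨q, tl⟩
  · have := suffixMaxima_eq_nil_iff.1 hsm
    omega
  obtain ⟨q1, q2, q3, q4⟩ := suffixMaxima_cons hsm
  rw [show i + 1 + (ρ - (i + 1)) = ρ by omega] at q1 q3 q4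
  rw [hsm] at ht hrun
  have hqX := h.X_le_of_le (s := i + 1) (t := q) q2 (by omega)
  have hqX' := h.X_lt (s := q) (by omega)
  have hqρ := h.X_le_of_le (s := q) (t := ρ - 1) (by omega) (by omega)
  have hqi := hmax q q3 (by omega)
  obtain ⟨j', hj'⟩ : ∃ j' : ℕ, chainX v L (i + 1) = chainX v L 0 + (j' + 1 : ℕ) :=
    ⟨(chainX v L (i + 1) - chainX v L 0 - 1).toNat, by push_cast; omega⟩
  have hmax' : ∀ t < ρ, chainX v L 0 + ((j' + 1 : ℕ) : ℤ) < chainX v L (t + 1) →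
      chainY v L t ≤ chainY v L q := fun t ht1 ht2 => by
    rw [← hj'] at ht2
    exact q1 t (Nat.lt_succ_iff.1 (h.lt_of_X_lt (by omega) ht2)) ht1
  have e1 : F (chainX v L 0 + j') = chainY v L i := by
    push_cast at hj'
    exact hconst _ (by omega) (by omega) (by omega)
  have e2 : F (chainX v L 0 + j' + 1) = chainY v L q := by
    push_cast at hj' hmax'
    refine (hF _ (by omega) (by omega)).unique
      ⟨⟨q, by omega, by omega, by omega, rfl⟩, fun t ht1 h1 h2 => hmax' t ?_ (by omega)⟩
    exact h.lt_of_X_lt ht1.le (by omega)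
  have hout : (if chainY v L q ≠ chainY v L i then
      s.out ++ [(chainX v L (i + 1), chainY v L i), (chainX v L (i + 1), chainY v L q)]
      else s.out) = breakpointsUpTo F (chainX v L 0) (j' + 1) := by
    push_cast at hj'
    rw [breakpointsUpTo_succ, breakpointsUpTo_eq_of_const (j := j) (k := j') (y := chainY v L i)
      (by omega) (fun p h1 h2 => hconst p h1 (by omega) (by omega)), I.out, transition,
      add_sub_cancel_right, e1, e2, hj', add_assoc]
    split_ifs <;> first | rfl | omega | simp
  have hlast' : ((if chainY v L q ≠ chainY v L i then
      s.out ++ [(chainX v L (i + 1), chainY v L i), (chainX v L (i + 1), chainY v L q)]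
      else s.out).getLastD (0, 0)).2 = chainY v L q := by
    split_ifs with hne
    · simp
    · rw [hlast]; omega
  refine ⟨(t + 1) + 1, _, q, j' + 1, Nat.succ_pos _, rfl, ?_, ?_⟩
  all_goals
    rw [Function.iterate_succ_apply, hstep, Function.iterate_succ_apply', hrun]
    have hY : (v (horizontalIdx L q)).2 = chainY v L q := rfl
    simp only [step, List.map_cons, I.support, hY, sub_sub_cancel,
      h.rightVertex_eq (k := q) (by omega)]
  · exact ⟨rfl, rfl, I.r, I.r, q3, le_rfl, I.le_m, by omega, by omega, by omega, by omega, hmax',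
      by rw [q4], hout, hlast'⟩
  · unfold potential
    simp only [List.length_map, List.length_cons] at ht ⊢
    omega

theorem reaches_done (h : IsLowerChain v L R m) (hw : 0 < w)
    (hF : ∀ p, chainX v L 0 ≤ p → p + w ≤ chainX v L m → IsWindowMax v L m w p (F p))
    {s : State n} {i σ ρ j : ℕ} (I : ScanInv v L m w F s i σ ρ j) :
    ∃ t ≤ potential m s i σ ρ, ((step v L R w)^[t] s).loc = Loc.done ∧
      ((step v L R w)^[t] s).out =
        breakpointsUpTo F (chainX v L 0) (chainX v L m - w - chainX v L 0).toNat ++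
          [(chainX v L m - w, F (chainX v L m - w))] := by
  induction hN : potential m s i σ ρ using Nat.strong_induction_on generalizing s i σ ρ j with
  | _ N ih =>
    have next : ∀ (t : ℕ) (s' : State n) (i' σ' ρ' j' : ℕ), 0 < t → (step v L R w)^[t] s = s' →
        ScanInv v L m w F s' i' σ' ρ' j' → potential m s' i' σ' ρ' + t ≤ N →
        ∃ t ≤ N, ((step v L R w)^[t] s).loc = Loc.done ∧ ((step v L R w)^[t] s).out =
          breakpointsUpTo F (chainX v L 0) (chainX v L m - w - chainX v L 0).toNat ++
            [(chainX v L m - w, F (chainX v L m - w))] := by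
      intro t s' i' σ' ρ' j' ht hs I' hp
      obtain ⟨t', ht', hd⟩ := ih _ (by omega) I' rfl
      refine ⟨t' + t, by omega, ?_⟩
      rwa [Function.iterate_add_apply, hs]
    rcases lt_or_ge (chainX v L ρ) (chainX v L (i + 1) + w) with hc | hc
    · by_cases hρ : ρ = m
      · exact ⟨1, by rw [← hN]; unfold potential; omega, I.finish h hF hc hρ⟩
      rcases le_or_gt (chainY v L ρ) (chainY v L i) with hY | hY
      · obtain ⟨I', hp⟩ := I.advance h hc hρ hY
        exact next 1 (step v L R w s) _ _ _ _ one_pos rfl I' (by omega)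
      · obtain ⟨j', I', hp⟩ := I.rise h hw hF hc hρ hY
        exact next 1 (step v L R w s) _ _ _ _ one_pos rfl I' (by omega)
    · obtain ⟨t, s', q, j', ht, hs, I', hp⟩ := I.fall h hw hF hc
      exact next t s' _ _ _ _ ht hs I' (by omega)

end ScanInv

end RectHole

open RectHole
theorem mainTheorem6 :
    ∃ K : ℕ, ∀ (n : ℕ) [NeZero n] (v : ZMod n → ℤ × ℤ) (L R : ZMod n) (w : ℕ),
      IsNiceHole v → IsLeftmostEdge v L → IsRightmostEdge v R →
      0 < w → (w : ℤ) ≤ (v (L + 2)).1 - (v (L + 1)).1 →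
      (∀ p ∈ Set.Icc (v L).1 ((v R).1 - w),
        IsLeast (barHeights v L R w p) (lowestBar v L R w p)) ∧
      ∃ t : ℕ, t ≤ K * n ∧
        ((step v L R w)^[t] (initial n)).loc = Loc.done ∧
        ((step v L R w)^[t] (initial n)).out.map toPlane =
          breakpoints (lowestBar v L R w) (v L).1 ((v R).1 - w) := by
  refine ⟨7, fun n _ v L R w hv hL hR hw hwX => ?_⟩
  obtain ⟨m, h⟩ := hv.exists_isLowerChain hL hR
  have hm := h.one_le
  have hX0 : (v (L + 1)).1 = chainX v L 0 := by simp [chainX]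
  have hX1 : (v (L + 2)).1 = chainX v L 1 := by
    have := h.vertical_X (k := 0) hm
    rw [← this, verticalIdx]
    norm_num
  have hXm := h.X_le_of_le (s := 1) (t := m) hm le_rfl
  rw [hX0, hX1] at hwX
  rw [h.X_L, h.X_R]
  have hex : ∀ p, ∃ y, chainX v L 0 ≤ p → p + w ≤ chainX v L m → IsWindowMax v L m w p y := by
    intro p
    by_cases hp : chainX v L 0 ≤ p ∧ p + w ≤ chainX v L m
    · obtain ⟨y, hy⟩ := IsLowerChain.exists_isWindowMax hw hp.1 hp.2
      exact ⟨y, fun _ _ => hy⟩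
    · exact ⟨0, fun h1 h2 => absurd ⟨h1, h2⟩ hp⟩
  choose F hF using hex
  have hbar : ∀ p, chainX v L 0 ≤ p → p ≤ chainX v L m - w → lowestBar v L R w p = F p :=
    fun p h1 h2 => h.lowestBar_eq hw h1 (by omega) (hF p h1 (by omega))
  refine ⟨fun p hp => ?_, ?_⟩
  · rw [hbar p hp.1 hp.2]
    exact h.isLeast_barHeights hw hp.1 (by have := hp.2; omega) (hF p hp.1 (by have := hp.2; omega))
  have hmax0 : ∀ k < 1, chainX v L 0 + ((0 : ℕ) : ℤ) < chainX v L (k + 1) →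
      chainY v L k ≤ chainY v L 0 := fun k hk _ => by
    obtain rfl : k = 0 := by omega
    exact le_rfl
  have hF0 : F (chainX v L 0) = chainY v L 0 := by
    refine (hF _ le_rfl (by omega)).unique
      ⟨⟨0, by omega, by omega, by rw [Nat.zero_add]; omega, rfl⟩, fun k hk h1 h2 => hmax0 k ?_ ?_⟩
    · exact h.lt_of_X_lt hk.le (by omega)
    · simpa using h2
  have hinit : ScanInv v L m w F (step v L R w (initial n)) 0 1 1 0 := by
    have e := h.onLine_eq (k := 0) hm (b := (chainX v L 0, chainY v L 0)) rfl
    have e2 : L + 2 = verticalIdx L (0 + 1) := by simp [verticalIdx]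
    simp only [step, initial, h.lower_L]
    rw [e2, e]
    refine ⟨rfl, rfl, rfl, rfl, one_pos, le_rfl, hm, ?_, ?_, ?_, ?_, hmax0, ?_, ?_, rfl⟩
    · omega
    · rw [Nat.zero_add]; omega
    · omega
    · rw [Nat.zero_add, Nat.sub_self]; omega
    · simp [suffixMaxima]
    · simp [breakpointsUpTo, hF0]
  obtain ⟨t, ht, hd, ho⟩ := ScanInv.reaches_done h hw hF hinit
  have hn := h.two_mul_lt
  refine ⟨t + 1, ?_, ?_, ?_⟩
  · have : potential m (step v L R w (initial n)) 0 1 1 ≤ 12 * m + 1 := by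
      unfold potential
      rw [hinit.Q]
      simp only [suffixMaxima, Nat.sub_self, Nat.zero_add, List.map_nil, List.length_nil]
      omega
    omega
  · rwa [Function.iterate_succ_apply]
  · rw [Function.iterate_succ_apply, ho, ← breakpoints_eq (f := lowestBar v L R w) (by omega) hbar]
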